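/- For $n\in\mathbb N$ let $\Sigma_n=\{-1,1\}^n$, fix $\sigma^*=\sigma^*_n\in\Sigma_n$ (an arbitrary choice for each $n$), and for $X\in\mathbb R^n$ and $\sigma\in\Sigma_n$ let \[ H(\sigma)=\frac1{\sqrt n}\Bigl|\sum_{i=1}^n\sigma(i)X_i\Bigr| . \] The planted measure $\mathbb P_{\rm pl}$ is the law of $X\sim\mathcal N(0,I_n)$ conditioned on the event $H(\sigma^*)\le 3^{-n}$. Let $d_H$ be the Hamming distance on $\Sigma_n$ and $h_b(p)=-p\log_2p-(1-p)\log_2(1-p)$. Fix $\rho\in(0,1)$ and, for each $n$, let $k_n\in\{\lfloor\rho n\rfloor,\lceil\rho n\rceil\}$ be $\rho n$ rounded to an integer (down or up, an arbitrary choice for each $n$; so $k_n=\rho n$ if $\rho n$ is an integer). Put \[ \zeta(\rho)=\zeta_n(\rho)=\min\bigl\{H(\sigma):\ \sigma\in\Sigma_n\setminus\{\pm\sigma^*\},\ d_H(\sigma,\sigma^*)=k_n\bigr\}, \] which is a minimum over a non-empty set for all large $n$. Let $f,g:\mathbb N\to(0,\infty)$ be arbitrary functions with $f(n)\to0$ and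 $g(n)\to\infty$ as $n\to\infty$. Then \[ \lim_{n\to\infty}\mathbb P_{\rm pl}\Bigl[f(n)\sqrt n\,2^{-n h_b(\rho)}\le\zeta(\rho)\le g(n)\sqrt n\,2^{-n h_b(\rho)}\Bigr]=1 . \] -/

import Mathlib

open Filter Topology MeasureTheory ProbabilityTheory

noncomputable section

namespace PlantedNPP

/-- The hypercube `{-1, 1}^n`; the two units of `ℤ` are `1` and `-1`. -/
abbrev Spin (n : ℕ) : Type := Fin n → ℤˣ

/-- The inner product `⟨σ, X⟩ = ∑ σ(i) X(i)`. -/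
def overlap {n : ℕ} (σ : Spin n) (X : Fin n → ℝ) : ℝ :=
  ∑ i, ((σ i : ℤ) : ℝ) * X i

/-- The Hamiltonian `H(σ) = n^{-1/2} |⟨σ, X⟩|`. -/
def hamiltonian {n : ℕ} (X : Fin n → ℝ) (σ : Spin n) : ℝ :=
  |overlap σ X| / √(n : ℝ)

/-- The law `N(0, I_n)` of `n` independent standard Gaussians. -/
def gaussianVector (n : ℕ) : Measure (Fin n → ℝ) :=
  Measure.pi fun _ => gaussianReal 0 1

/-- The planted measure: `X ~ N(0, I_n)` conditioned on `H(σ*) ≤ 3^{-n}`. -/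
def plantedMeasure {n : ℕ} (σstar : Spin n) : Measure (Fin n → ℝ) :=
  ProbabilityTheory.cond (gaussianVector n) {X | hamiltonian X σstar ≤ ((3 : ℝ) ^ n)⁻¹}

/-- The `σ` other than `±σ*` at Hamming distance exactly `k` from `σ*`. -/
def sphere {n : ℕ} (σstar : Spin n) (k : ℕ) : Set (Spin n) :=
  {σ | σ ≠ σstar ∧ σ ≠ -σstar ∧ hammingDist σ σstar = k}

/-- The smallest value of `H` on `sphere σ* k`. For `0 < k < n` it is an attained minimum
(see `isLeast_zeta`); for other `k` the sphere is empty and the value is a dummy. -/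
def zeta {n : ℕ} (σstar : Spin n) (k : ℕ) (X : Fin n → ℝ) : ℝ :=
  sInf (hamiltonian X '' sphere σstar k)

/-- The binary entropy function with logarithm to base `2`. -/
def hb (p : ℝ) : ℝ := -p * Real.logb 2 p - (1 - p) * Real.logb 2 (1 - p)

theorem sphere_nonempty {n : ℕ} (σstar : Spin n) {k : ℕ} (h0 : 0 < k) (hn : k < n) :
    (sphere σstar k).Nonempty := by
  classical
  obtain ⟨s, -, hs⟩ := Finset.exists_subset_card_eq
    (s := (Finset.univ : Finset (Fin n))) (n := k) (by simpa using hn.le)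
  have hne : ∀ u : ℤˣ, -u ≠ u := by decide
  have hd : hammingDist (fun i => if i ∈ s then -σstar i else σstar i) σstar = k := by
    rw [← hs, hammingDist]
    congr 1
    ext i
    by_cases hi : i ∈ s <;> simp [hi, hne]
  refine ⟨fun i => if i ∈ s then -σstar i else σstar i, ?_, ?_, hd⟩
  · intro h
    rw [h, hammingDist_self] at hd
    omega
  · intro h
    have hall : hammingDist (-σstar) σstar = n := by
      simp [hammingDist, hne]
    rw [h, hall] at hd
    omega

theorem isLeast_zeta {n : ℕ} (σstar : Spin n) {k : ℕ} (h0 : 0 < k) (hn : k < n)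
    (X : Fin n → ℝ) : IsLeast (hamiltonian X '' sphere σstar k) (zeta σstar k X) := by
  have hne : (hamiltonian X '' sphere σstar k).Nonempty := (sphere_nonempty σstar h0 hn).image _
  have hfin : (hamiltonian X '' sphere σstar k).Finite := (Set.toFinite _).image _
  exact ⟨hne.csInf_mem hfin, fun _ hx => csInf_le hfin.bddBelow hx⟩

end PlantedNPP

end

/-!
The proof is a first and second moment computation for the number `M` of spins at distance `k` from
`σ*` with `H(σ) ≤ t`. Flipping the signs in a `k`-subset `S` of the coordinates (`flip`) indexes
these spins by the `N = C(n, k)` sets `S`, and `H(σ) = |⟨σ / √n, X⟩|` for the unit vector `σ / √n`.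

Conditionally on the planted coordinate `⟨σ*, X⟩ / √n`, which is at most `3⁻ⁿ` in absolute value,
each `⟨σ, X⟩ / √n` is Gaussian with standard deviation `s = 2 √(κ (1 - κ))`, `κ = k / n`, and a
mean of size at most `3⁻ⁿ`. Hence `P(H(σ) ≤ t)` is at most `u = 2t / (s √(2π))`, and asymptotically
equal to it as `t → 0` and `n → ∞` (`planted_flip_le`, `le_planted_flip`). By Stirling's formula
(`choose_two_sided`), for `t = w √n 2 ^ (-n h(ρ))` the expected number `N u` has the order of `w`.
With `w = f n → 0` a union bound gives the lower bound on the minimum.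

For the upper bound, with `w → ∞`, the second moment is needed. For two sets meeting in `j` points
the conditional correlation is `r = (n j - k²) / (k (n - k))` (`setCorr`), and the joint probability
is at most `u² / √(1 - r²)`. Unless the sets are equal or complementary, `1 - r² ≥ 1 / n`
(`setCorr_sq_le`), so that `1 / √(1 - r²) ≤ 1 + √n r²`; and the average of `r²` over a random
second set is `O(1 / n)`, a hypergeometric variance (`sum_setCorr_sq_le`). Thus
`E[M²] ≤ (N u)² (1 + O(n ^ (-1/2))) + 2 N u` (`sum_planted_flip_pair_le`), and
`1_{M = 0} ≤ (1 - M / (N u))²` yields `P(M = 0) → 0` (`planted_forall_lt_le`).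
-/

namespace PlantedNPP

/-! ### Intersections of `k`-subsets -/

/-- The correlation coefficient of two `k`-subsets of an `n`-set meeting in `j` points, that is,
the correlation of their centred indicator vectors. -/
noncomputable def setCorr (n k j : ℕ) : ℝ :=
  ((n : ℝ) * j - (k : ℝ) ^ 2) / ((k : ℝ) * ((n : ℝ) - k))

theorem sum_card_inter {n k : ℕ} (hk : 0 < k) (hkn : k < n) {S : Finset (Fin n)}
    (hS : S.card = k) :
    (n : ℝ) * ∑ T ∈ (Finset.univ : Finset (Fin n)).powersetCard k, ((S ∩ T).card : ℝ)
      = (n.choose k : ℝ) * (k : ℝ) ^ 2 := by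
  have h1 : ∀ T : Finset (Fin n), ((S ∩ T).card : ℝ)
      = ∑ i ∈ S, if {i} ⊆ T then (1 : ℝ) else 0 := by
    intro T
    rw [Finset.sum_boole]
    congr 2
    ext i; simp
  simp_rw [h1]
  rw [Finset.sum_comm]
  have h2 : ∀ i ∈ S, ∑ T ∈ (Finset.univ : Finset (Fin n)).powersetCard k,
      (if {i} ⊆ T then (1 : ℝ) else 0) = ((n - 1).choose (k - 1) : ℝ) := by
    intro i _
    rw [Finset.sum_boole, Finset.card_filter_powersetCard_subset _ _ _ (by simp)
      (by simpa using Nat.succ_le_of_lt hk)]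
    simp
  rw [Finset.sum_congr rfl h2, Finset.sum_const, hS, nsmul_eq_mul]
  obtain ⟨n, rfl⟩ := Nat.exists_eq_succ_of_ne_zero (by omega : n ≠ 0)
  obtain ⟨k, rfl⟩ := Nat.exists_eq_succ_of_ne_zero hk.ne'
  have := Nat.add_one_mul_choose_eq n k
  have h3 : ((n : ℝ) + 1) * (n.choose k) = ((n + 1).choose (k + 1)) * ((k : ℝ) + 1) := by
    exact_mod_cast this
  simp only [Nat.succ_eq_add_one, Nat.add_sub_cancel]
  push_cast
  linear_combination ((k : ℝ) + 1) * h3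

theorem sum_card_inter_sq {n k : ℕ} (hk : 0 < k) (hkn : k < n) {S : Finset (Fin n)}
    (hS : S.card = k) :
    (n : ℝ) ^ 2 * ∑ T ∈ (Finset.univ : Finset (Fin n)).powersetCard k, ((S ∩ T).card : ℝ) ^ 2
      ≤ (n.choose k : ℝ) * (n * (k : ℝ) ^ 2 + (k : ℝ) ^ 4) := by
  have h1 : ∀ T : Finset (Fin n), ((S ∩ T).card : ℝ) ^ 2
      = (S ∩ T).card + ∑ p ∈ S.offDiag, if {p.1, p.2} ⊆ T then (1 : ℝ) else 0 := by
    intro T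
    rw [Finset.sum_boole]
    have : {p ∈ S.offDiag | {p.1, p.2} ⊆ T} = (S ∩ T).offDiag := by
      ext p
      simp only [Finset.mem_filter, Finset.mem_offDiag, Finset.insert_subset_iff,
        Finset.singleton_subset_iff, Finset.mem_inter]
      tauto
    rw [this, Finset.offDiag_card, Nat.cast_sub (Nat.le_mul_self _)]
    push_cast; ring
  simp_rw [h1]
  rw [Finset.sum_add_distrib, Finset.sum_comm (s := Finset.powersetCard k _), mul_add]
  have hA : (n : ℝ) ^ 2 * ∑ T ∈ (Finset.univ : Finset (Fin n)).powersetCard k, ((S ∩ T).card : ℝ)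
      = n * ((n.choose k : ℝ) * (k : ℝ) ^ 2) := by
    rw [← sum_card_inter hk hkn hS]; ring
  have hB : (n : ℝ) ^ 2 * ∑ p ∈ S.offDiag, ∑ T ∈ (Finset.univ : Finset (Fin n)).powersetCard k,
      (if {p.1, p.2} ⊆ T then (1 : ℝ) else 0) ≤ (n.choose k : ℝ) * (k : ℝ) ^ 4 := by
    obtain rfl | hk2 : k = 1 ∨ 2 ≤ k := by omega
    · have : S.offDiag = ∅ := by
        rw [← Finset.card_eq_zero, Finset.offDiag_card, hS]
      rw [this]; simp
    have h2 : ∀ p ∈ S.offDiag, ∑ T ∈ (Finset.univ : Finset (Fin n)).powersetCard k,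
        (if {p.1, p.2} ⊆ T then (1 : ℝ) else 0) = ((n - 2).choose (k - 2) : ℝ) := by
      intro p hp
      have hne : p.1 ≠ p.2 := (Finset.mem_offDiag.1 hp).2.2
      rw [Finset.sum_boole, Finset.card_filter_powersetCard_subset _ _ _ (by simp)
        (by rw [Finset.card_pair hne]; exact hk2), Finset.card_pair hne]
      simp
    rw [Finset.sum_congr rfl h2, Finset.sum_const, Finset.offDiag_card, hS, nsmul_eq_mul,
      Nat.cast_sub (Nat.le_mul_self _)]
    obtain ⟨k, rfl⟩ := Nat.exists_eq_add_of_le' hk2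
    obtain ⟨n, rfl⟩ := Nat.exists_eq_add_of_le' (by omega : 2 ≤ n)
    have e1 := Nat.add_one_mul_choose_eq n k
    have e2 := Nat.add_one_mul_choose_eq (n + 1) (k + 1)
    have e1' : ((n : ℝ) + 1) * (n.choose k) = ((n + 1).choose (k + 1)) * ((k : ℝ) + 1) := by
      exact_mod_cast e1
    have e2' : ((n : ℝ) + 2) * ((n + 1).choose (k + 1))
        = ((n + 2).choose (k + 2)) * ((k : ℝ) + 2) := by
      exact_mod_cast e2
    have hkn' : (k : ℝ) ≤ n := by exact_mod_cast (by omega : k ≤ n)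
    simp only [Nat.add_sub_cancel]
    push_cast
    set c := (n.choose k : ℝ)
    set d := ((n + 2).choose (k + 2) : ℝ)
    have hd : 0 ≤ d := Nat.cast_nonneg _
    have hc : 0 ≤ c := Nat.cast_nonneg _
    have e3 : ((n : ℝ) + 2) * ((n + 1) * c) = d * (k + 2) * (k + 1) := by
      rw [e1', ← e2']; ring
    -- Sampling without replacement is negatively correlated: `(k-1)/(n-1) ≤ k/n`.
    have e4 : ((n : ℝ) + 2) * ((k + 1) * c) ≤ d * (k + 2) * ((k + 1) * (k + 2) / (n + 2)) := by
      have hn1 : (0 : ℝ) < n + 1 := by positivity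
      have hn2 : (0 : ℝ) < n + 2 := by positivity
      have : ((n : ℝ) + 2) * ((k + 1) * c) = d * (k + 2) * ((k + 1) * ((k + 1) / (n + 1))) := by
        field_simp; linear_combination e3
      rw [this]
      have h5 : ((k : ℝ) + 1) / (n + 1) ≤ (k + 2) / (n + 2) := by
        rw [div_le_div_iff₀ hn1 hn2]; nlinarith
      calc d * (k + 2) * ((k + 1) * ((k + 1) / (n + 1)))
          ≤ d * (k + 2) * ((k + 1) * ((k + 2) / (n + 2))) := by gcongr
        _ = _ := by ring
    have hn2 : (0 : ℝ) < n + 2 := by positivity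
    calc ((n : ℝ) + 2) ^ 2 * (((k + 2) * (k + 2) - (k + 2)) * c)
        = ((n : ℝ) + 2) * (k + 2) * (((n : ℝ) + 2) * ((k + 1) * c)) := by ring
      _ ≤ ((n : ℝ) + 2) * (k + 2) * (d * (k + 2) * ((k + 1) * (k + 2) / (n + 2))) := by gcongr
      _ = d * ((k + 2) ^ 3 * (k + 1)) := by field_simp
      _ ≤ d * (k + 2) ^ 4 := by
          rw [pow_succ _ 3]; gcongr; norm_num
  rw [mul_add]
  linarith

/-- The squared correlation of a fixed `k`-subset with a uniformly random one is `O(1/n)` on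
average. -/
theorem sum_setCorr_sq_le {n k : ℕ} (hk : 0 < k) (hkn : k < n) {S : Finset (Fin n)}
    (hS : S.card = k) :
    ∑ T ∈ (Finset.univ : Finset (Fin n)).powersetCard k, setCorr n k (S ∩ T).card ^ 2
      ≤ (n.choose k : ℝ) * n / ((n : ℝ) - k) ^ 2 := by
  have hk' : (0 : ℝ) < k := by exact_mod_cast hk
  have hkn' : (0 : ℝ) < (n : ℝ) - k := by rw [sub_pos]; exact_mod_cast hkn
  simp only [setCorr, div_pow]
  rw [← Finset.sum_div, div_le_div_iff₀ (by positivity) (by positivity)]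
  have key : ∑ T ∈ (Finset.univ : Finset (Fin n)).powersetCard k,
      ((n : ℝ) * (S ∩ T).card - (k : ℝ) ^ 2) ^ 2 ≤ (n.choose k : ℝ) * (n * (k : ℝ) ^ 2) := by
    have : ∀ T : Finset (Fin n), ((n : ℝ) * (S ∩ T).card - (k : ℝ) ^ 2) ^ 2
        = (n : ℝ) ^ 2 * ((S ∩ T).card : ℝ) ^ 2 - 2 * (k : ℝ) ^ 2 * (n * ((S ∩ T).card : ℝ))
          + (k : ℝ) ^ 4 := by
      intro T; ring
    simp_rw [this]
    rw [Finset.sum_add_distrib, Finset.sum_sub_distrib, ← Finset.mul_sum, ← Finset.mul_sum,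
      ← Finset.mul_sum, sum_card_inter hk hkn hS, Finset.sum_const, Finset.card_powersetCard,
      Finset.card_univ, Fintype.card_fin, nsmul_eq_mul]
    have := sum_card_inter_sq hk hkn hS
    linarith
  calc _ ≤ (n.choose k : ℝ) * (n * (k : ℝ) ^ 2) * ((n : ℝ) - k) ^ 2 := by gcongr
    _ = _ := by ring

/-- Two `k`-subsets that are neither equal nor complementary have correlation bounded away from
`±1` by a multiple of `1/n`. -/
theorem setCorr_sq_le {n k : ℕ} (hk : 0 < k) (hkn : k < n) {S T : Finset (Fin n)}
    (hS : S.card = k) (hT : T.card = k) (h1 : T ≠ S) (h2 : T ≠ Sᶜ) :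
    setCorr n k (S ∩ T).card ^ 2 ≤ 1 - 1 / n := by
  have hn : (0 : ℝ) < n := by exact_mod_cast hk.trans hkn
  have hk' : (0 : ℝ) < k := by exact_mod_cast hk
  have hkn' : (0 : ℝ) < (n : ℝ) - k := by rw [sub_pos]; exact_mod_cast hkn
  have hD : (0 : ℝ) < (k : ℝ) * ((n : ℝ) - k) := mul_pos hk' hkn'
  have hjk : (S ∩ T).card < k := by
    refine lt_of_le_of_ne (hS ▸ Finset.card_le_card Finset.inter_subset_left) fun h => h1 ?_
    have a : S ∩ T = S := Finset.eq_of_subset_of_card_le Finset.inter_subset_left (by omega)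
    have b : S ∩ T = T := Finset.eq_of_subset_of_card_le Finset.inter_subset_right (by omega)
    exact b.symm.trans a
  have hun : (S ∪ T).card + (S ∩ T).card = k + k := by
    rw [Finset.card_union_add_card_inter, hS, hT]
  have hle : (S ∪ T).card ≤ n := by simpa using Finset.card_le_univ (S ∪ T)
  have h0 : (S ∩ T).card = 0 → 2 * k < n := by
    intro h
    refine lt_of_le_of_ne (by omega) fun h' => h2 ?_
    have hd : Disjoint T S := by
      rw [disjoint_comm, Finset.disjoint_iff_inter_eq_empty]; exact Finset.card_eq_zero.1 h
    refine Finset.eq_of_subset_of_card_le (Finset.subset_compl_iff_disjoint_right.2 hd) ?_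
    rw [Finset.card_compl, hS, hT, Fintype.card_fin]; omega
  set j := (S ∩ T).card
  set r := setCorr n k j with hr
  have hjk' : (j : ℝ) + 1 ≤ k := by exact_mod_cast hjk
  have hj0 : (0 : ℝ) ≤ j := Nat.cast_nonneg _
  have e1 : 1 - r = n * ((k : ℝ) - j) / (k * ((n : ℝ) - k)) := by
    rw [hr, setCorr]; field_simp; ring
  have e2 : 1 + r = (n * (j : ℝ) + k * (n - 2 * k)) / (k * ((n : ℝ) - k)) := by
    rw [hr, setCorr]; field_simp; ring
  have b1 : 1 / (n : ℝ) ≤ 1 - r := by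
    rw [e1, div_le_div_iff₀ hn hD]
    nlinarith [mul_pos hk' hk', mul_pos hn hn]
  have b2 : 1 / (n : ℝ) ≤ 1 + r := by
    rw [e2, div_le_div_iff₀ hn hD]
    obtain h | h : n < 2 * k ∨ 2 * k ≤ n := by omega
    · have h3 : (2 * k : ℝ) ≤ n + j := by exact_mod_cast (by omega : 2 * k ≤ n + j)
      have h4 : (n : ℝ) + 1 ≤ 2 * k := by exact_mod_cast h
      have h5 : (n : ℝ) - k ≤ n * (j : ℝ) + k * (n - 2 * k) := by nlinarith
      nlinarith
    · have h3 : (2 * k : ℝ) ≤ n := by exact_mod_cast h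
      obtain h4 | h4 := Nat.eq_zero_or_pos j
      · have h5 : (2 * k : ℝ) + 1 ≤ n := by exact_mod_cast h0 h4
        have h6 : (k : ℝ) ≤ n * (j : ℝ) + k * (n - 2 * k) := by rw [h4]; push_cast; nlinarith
        nlinarith
      · have h5 : (1 : ℝ) ≤ j := by exact_mod_cast h4
        have h6 : (n : ℝ) ≤ n * (j : ℝ) + k * (n - 2 * k) := by nlinarith
        nlinarith
  obtain h | h := le_total 0 r
  · nlinarith [mul_nonneg h (sub_nonneg.2 b1), one_div_pos.2 hn]
  · nlinarith [mul_nonneg (neg_nonneg.2 h) (sub_nonneg.2 b2), one_div_pos.2 hn]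

/-! ### Binomial coefficients and binary entropy -/

theorem hb_eq_binEntropy_div (p : ℝ) : hb p = Real.binEntropy p / Real.log 2 := by
  simp only [hb, Real.binEntropy, Real.logb, Real.log_inv]
  ring

theorem two_rpow_neg_mul_hb (x p : ℝ) :
    (2 : ℝ) ^ (-(x * hb p)) = Real.exp (-(x * Real.binEntropy p)) := by
  rw [Real.rpow_def_of_pos two_pos, hb_eq_binEntropy_div]
  congr 1
  have : Real.log 2 ≠ 0 := (Real.log_pos one_lt_two).ne'
  field_simp

theorem abs_sub_le_one_of_rounding {x : ℝ} (hx : 0 ≤ x) {k : ℕ} (hk : k = ⌊x⌋₊ ∨ k = ⌈x⌉₊) :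
    |(k : ℝ) - x| ≤ 1 := by
  rw [abs_le]
  obtain rfl | rfl := hk
  · constructor <;> linarith [Nat.floor_le hx, Nat.lt_floor_add_one x]
  · constructor <;> linarith [Nat.le_ceil x, Nat.ceil_lt_add_one hx]

theorem tendsto_div_of_rounding {ρ : ℝ} {k : ℕ → ℕ} (hk : ∀ n : ℕ, |(k n : ℝ) - ρ * n| ≤ 1) :
    Tendsto (fun n => (k n : ℝ) / n) atTop (𝓝 ρ) := by
  rw [tendsto_iff_norm_sub_tendsto_zero]
  refine squeeze_zero' (.of_forall fun _ => norm_nonneg _) ?_ tendsto_one_div_atTop_nhds_zero_nat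
  filter_upwards [eventually_gt_atTop 0] with n hn
  have hn' : (0 : ℝ) < n := by exact_mod_cast hn
  rw [show (k n : ℝ) / n - ρ = ((k n : ℝ) - ρ * n) / n by field_simp, Real.norm_eq_abs, abs_div,
    abs_of_pos hn']
  gcongr
  exact hk n

/-- The exact form of Stirling's formula for binomial coefficients. -/
theorem choose_mul_sqrt_eq {n k : ℕ} (hk : 0 < k) (hkn : k < n) :
    (n.choose k : ℝ) * √n = Stirling.stirlingSeq n / (Stirling.stirlingSeq k *
      Stirling.stirlingSeq (n - k)) * (1 / √(2 * ((k : ℝ) / n) * (1 - (k : ℝ) / n))) *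
      Real.exp (n * Real.binEntropy ((k : ℝ) / n)) := by
  obtain ⟨m, rfl⟩ := Nat.exists_eq_add_of_le hkn.le
  have hm : 0 < m := by omega
  have hk' : (0 : ℝ) < k := by exact_mod_cast hk
  have hm' : (0 : ℝ) < m := by exact_mod_cast hm
  have hn' : (0 : ℝ) < (k : ℝ) + m := by positivity
  have hF : ∀ j : ℕ, 0 < j →
      (j.factorial : ℝ) = Stirling.stirlingSeq j * (√(2 * j) * (j / Real.exp 1) ^ j) := by
    intro j hj
    have : (0 : ℝ) < j := by exact_mod_cast hj
    rw [Stirling.stirlingSeq]; field_simp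
  have hS : ∀ j : ℕ, 0 < j → 0 < Stirling.stirlingSeq j := by
    intro j hj
    obtain ⟨j, rfl⟩ := Nat.exists_eq_succ_of_ne_zero hj.ne'
    exact Stirling.stirlingSeq'_pos j
  have hexp : Real.exp (((k + m : ℕ) : ℝ) * Real.binEntropy ((k : ℝ) / ((k + m : ℕ) : ℝ)))
      = ((k : ℝ) + m) ^ (k + m) / ((k : ℝ) ^ k * (m : ℝ) ^ m) := by
    have h1 : 1 - (k : ℝ) / ((k : ℝ) + m) = m / (k + m) := by field_simp; ring
    push_cast
    rw [Real.binEntropy, h1, inv_div, inv_div, Real.log_div hn'.ne' hk'.ne',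
      Real.log_div hn'.ne' hm'.ne']
    have h2 : ((k : ℝ) + m) * (k / (k + m) * (Real.log (k + m) - Real.log k) +
        m / (k + m) * (Real.log (k + m) - Real.log m))
        = Real.log (k + m) * ((k + m : ℕ) : ℝ) - (Real.log k * k + Real.log m * m) := by
      push_cast; field_simp; ring
    rw [h2, Real.exp_sub, Real.exp_add, ← Real.rpow_def_of_pos hn', ← Real.rpow_def_of_pos hk',
      ← Real.rpow_def_of_pos hm', Real.rpow_natCast, Real.rpow_natCast, Real.rpow_natCast]
  have hsq : √((k + m : ℕ) : ℝ) * √(2 * ((k + m : ℕ) : ℝ)) / (√(2 * (k : ℝ)) * √(2 * (m : ℝ)))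
      = 1 / √(2 * ((k : ℝ) / ((k + m : ℕ) : ℝ)) * (1 - (k : ℝ) / ((k + m : ℕ) : ℝ))) := by
    rw [← Real.sqrt_mul (by positivity), ← Real.sqrt_mul (by positivity),
      ← Real.sqrt_div (by positivity), ← Real.sqrt_one, ← Real.sqrt_div (by positivity)]
    simp only [Real.sqrt_one]
    congr 1
    push_cast
    have h1 : 1 - (k : ℝ) / ((k : ℝ) + m) = m / (k + m) := by field_simp; ring
    rw [h1]; field_simp
  rw [hexp, ← hsq, Nat.cast_choose ℝ hkn.le, Nat.add_sub_cancel_left, hF _ (hk.trans hkn),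
    hF k hk, hF m hm]
  have := hS k hk
  have := hS m hm
  push_cast
  simp only [div_pow, pow_add]
  field_simp

/-- `C(n, k) ≍ 2 ^ (n h(ρ)) / √n` for `k = ρ n + O(1)`. -/
theorem choose_two_sided {ρ : ℝ} (hρ0 : 0 < ρ) (hρ1 : ρ < 1) {k : ℕ → ℕ}
    (hk : ∀ n : ℕ, |(k n : ℝ) - ρ * n| ≤ 1) :
    ∃ c C : ℝ, 0 < c ∧ ∀ᶠ n : ℕ in atTop,
      c ≤ (n.choose (k n) : ℝ) * (√n * (2 : ℝ) ^ (-((n : ℝ) * hb ρ))) ∧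
      (n.choose (k n) : ℝ) * (√n * (2 : ℝ) ^ (-((n : ℝ) * hb ρ))) ≤ C := by
  have hκ := tendsto_div_of_rounding hk
  have hpos : ∀ᶠ n : ℕ in atTop, 0 < (k n : ℝ) / n := hκ.eventually (lt_mem_nhds hρ0)
  have hlt : ∀ᶠ n : ℕ in atTop, (k n : ℝ) / n < 1 := hκ.eventually (gt_mem_nhds hρ1)
  have hnat : Tendsto (fun n : ℕ => (n : ℝ)) atTop atTop := tendsto_natCast_atTop_atTop
  have hk_top : Tendsto k atTop atTop := by
    rw [← tendsto_natCast_atTop_iff (R := ℝ)]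
    refine tendsto_atTop_mono (f := fun n : ℕ => ρ * n + -1) (fun n => ?_)
      (tendsto_atTop_add_const_right _ _ (hnat.const_mul_atTop hρ0))
    linarith [(abs_le.1 (hk n)).1]
  have hnk_top : Tendsto (fun n => n - k n) atTop atTop := by
    rw [← tendsto_natCast_atTop_iff (R := ℝ)]
    refine tendsto_atTop_mono (f := fun n : ℕ => (1 - ρ) * n + -1) (fun n => ?_)
      (tendsto_atTop_add_const_right _ _ (hnat.const_mul_atTop (sub_pos.2 hρ1)))
    have h1 : (n : ℝ) ≤ ((n - k n : ℕ) : ℝ) + k n := by exact_mod_cast (by omega)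
    linarith [(abs_le.1 (hk n)).2]
  have hS := Stirling.tendsto_stirlingSeq_sqrt_pi
  have hπ : 0 < √Real.pi := Real.sqrt_pos.2 Real.pi_pos
  have hρ' : 0 < √(2 * ρ * (1 - ρ)) :=
    Real.sqrt_pos.2 (mul_pos (by positivity) (sub_pos.2 hρ1))
  have hA : Tendsto (fun n => Stirling.stirlingSeq n / (Stirling.stirlingSeq (k n) *
      Stirling.stirlingSeq (n - k n)) * (1 / √(2 * ((k n : ℝ) / n) * (1 - (k n : ℝ) / n)))) atTop
      (𝓝 (√Real.pi / (√Real.pi * √Real.pi) * (1 / √(2 * ρ * (1 - ρ))))) := by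
    refine (hS.div ((hS.comp hk_top).mul (hS.comp hnk_top)) (by positivity)).mul
      (tendsto_const_nhds.div ?_ hρ'.ne')
    exact (Real.continuous_sqrt.tendsto _).comp
      ((hκ.const_mul 2).mul (tendsto_const_nhds.sub hκ))
  set a := √Real.pi / (√Real.pi * √Real.pi) * (1 / √(2 * ρ * (1 - ρ))) with ha
  have hapos : 0 < a := by positivity
  have hB : ∃ B : ℝ, ∀ᶠ n : ℕ in atTop,
      |n * (Real.binEntropy ((k n : ℝ) / n) - Real.binEntropy ρ)| ≤ B := by
    have hd := (Real.differentiableAt_binEntropy hρ0.ne' hρ1.ne).hasDerivAt.isBigO_sub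
    obtain ⟨B, hB⟩ := (hd.comp_tendsto hκ).bound
    refine ⟨|B|, ?_⟩
    filter_upwards [hB, eventually_gt_atTop 0] with n h hn
    have hn' : (0 : ℝ) < n := by exact_mod_cast hn
    simp only [Function.comp_apply, Real.norm_eq_abs] at h
    have h1 : |(k n : ℝ) / n - ρ| ≤ 1 / n := by
      rw [show (k n : ℝ) / n - ρ = ((k n : ℝ) - ρ * n) / n by field_simp, abs_div, abs_of_pos hn']
      gcongr
      exact hk n
    rw [abs_mul, abs_of_pos hn']
    calc (n : ℝ) * |Real.binEntropy ((k n : ℝ) / n) - Real.binEntropy ρ|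
        ≤ n * (|B| * (1 / n)) := by
          gcongr
          exact h.trans (mul_le_mul (le_abs_self B) h1 (abs_nonneg _) (abs_nonneg _))
      _ = |B| := by field_simp
  obtain ⟨B, hB⟩ := hB
  refine ⟨a / 2 * Real.exp (-B), 2 * a * Real.exp B, by positivity, ?_⟩
  filter_upwards [hpos, hlt, eventually_gt_atTop 0, hB,
    hA.eventually (lt_mem_nhds (half_lt_self hapos)),
    hA.eventually (gt_mem_nhds (by linarith : a < 2 * a))] with n h0 h1 hn hBn hl hu
  have hn' : (0 : ℝ) < n := by exact_mod_cast hn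
  have hk0 : 0 < k n := by
    rw [Nat.pos_iff_ne_zero]; rintro h; rw [h] at h0; simp at h0
  have hkn : k n < n := by rw [div_lt_one hn'] at h1; exact_mod_cast h1
  rw [← mul_assoc, choose_mul_sqrt_eq hk0 hkn, two_rpow_neg_mul_hb, mul_assoc _ (Real.exp _),
    ← Real.exp_add, ← sub_eq_add_neg, ← mul_sub]
  rw [abs_le] at hBn
  exact ⟨mul_le_mul hl.le (Real.exp_le_exp.2 hBn.1) (Real.exp_pos _).le
      ((half_pos hapos).le.trans hl.le),
    mul_le_mul hu.le (Real.exp_le_exp.2 hBn.2) (Real.exp_pos _).le (by positivity)⟩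

/-! ### Gaussian small-ball estimates -/

instance isProbabilityMeasure_gaussianVector (n : ℕ) : IsProbabilityMeasure (gaussianVector n) := by
  unfold gaussianVector; infer_instance

theorem measurable_mulVec_left {d n : ℕ} (A : Matrix (Fin d) (Fin n) ℝ) :
    Measurable fun X : Fin n → ℝ => A.mulVec X :=
  (Continuous.matrix_mulVec continuous_const continuous_id).measurable

/-- Orthonormal linear forms of a standard Gaussian vector are independent standard Gaussians. -/
theorem gaussianVector_map_mulVec {d n : ℕ} (A : Matrix (Fin d) (Fin n) ℝ)
    (hA : A * A.transpose = 1) :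
    (gaussianVector n).map (fun X => A.mulVec X) = gaussianVector d := by
  have hmeas := measurable_mulVec_left A
  -- Compare characteristic functions: that of the left side at `t` is the one of the standard
  -- Gaussian at `Aᵀ t`, and `Aᵀ` is an isometry.
  have hinj : Function.Injective (fun μ : Measure (Fin d → ℝ) => μ.map (WithLp.toLp 2)) :=
    (MeasurableEquiv.toLp 2 (Fin d → ℝ)).map_measurableEquiv_injective
  refine hinj ?_
  simp only [gaussianVector]
  rw [map_pi_eq_stdGaussian, Measure.map_map (by fun_prop) hmeas]
  have : IsFiniteMeasure ((Measure.pi fun _ : Fin n => gaussianReal 0 1).map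
      (WithLp.toLp 2 ∘ fun X : Fin n → ℝ => A.mulVec X)) := inferInstance
  apply Measure.ext_of_charFun (E := EuclideanSpace ℝ (Fin d))
  ext t
  have hin : ∀ X : Fin n → ℝ, inner ℝ (WithLp.toLp 2 (A.mulVec X)) t
      = inner ℝ (WithLp.toLp 2 X) (WithLp.toLp 2 (A.transpose.mulVec t.ofLp)) := by
    intro X
    simp only [PiLp.inner_apply, RCLike.inner_apply, conj_trivial]
    change t.ofLp ⬝ᵥ A.mulVec X = A.transpose.mulVec t.ofLp ⬝ᵥ X
    rw [Matrix.dotProduct_mulVec, Matrix.mulVec_transpose]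
  have hnorm : ‖(WithLp.toLp 2 (A.transpose.mulVec t.ofLp) : EuclideanSpace ℝ (Fin n))‖ ^ 2
      = ‖t‖ ^ 2 := by
    rw [← real_inner_self_eq_norm_sq, ← hin, Matrix.mulVec_mulVec, hA, Matrix.one_mulVec,
      ← real_inner_self_eq_norm_sq]
  have h2 := charFun_stdGaussian (WithLp.toLp 2 (A.transpose.mulVec t.ofLp))
  rw [charFun_stdGaussian, ← Complex.ofReal_pow, ← hnorm, Complex.ofReal_pow, ← h2,
    ← map_pi_eq_stdGaussian, charFun_apply, charFun_apply,
    integral_map ((Measurable.comp (by fun_prop) hmeas).aemeasurable) (by fun_prop),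
    integral_map (by fun_prop) (by fun_prop)]
  simp only [Function.comp_apply, hin]

theorem gaussianVector_map_pair {n : ℕ} {a b : Fin n → ℝ} (haa : a ⬝ᵥ a = 1) (hbb : b ⬝ᵥ b = 1)
    (hab : a ⬝ᵥ b = 0) :
    (gaussianVector n).map (fun X => (a ⬝ᵥ X, b ⬝ᵥ X))
      = (gaussianReal 0 1).prod (gaussianReal 0 1) := by
  have hba : b ⬝ᵥ a = 0 := by rw [dotProduct_comm, hab]
  have h := gaussianVector_map_mulVec (Matrix.of ![a, b]) (by
    ext i j
    change ![a, b] i ⬝ᵥ ![a, b] j = _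
    fin_cases i <;> fin_cases j <;>
      first
      | simpa using haa
      | simpa using hab
      | simpa using hba
      | simpa using hbb)
  have h2 := (measurePreserving_finTwoArrow (gaussianReal 0 1)).map_eq
  have h3 : gaussianVector 2 = Measure.pi fun _ => gaussianReal 0 1 := rfl
  rw [← h3, ← h, Measure.map_map (MeasurableEquiv.measurable _)
    (measurable_mulVec_left _)] at h2
  rw [← h2]
  rfl

theorem gaussianVector_map_triple {n : ℕ} {a b c : Fin n → ℝ} (haa : a ⬝ᵥ a = 1)
    (hbb : b ⬝ᵥ b = 1) (hcc : c ⬝ᵥ c = 1) (hab : a ⬝ᵥ b = 0) (hac : a ⬝ᵥ c = 0)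
    (hbc : b ⬝ᵥ c = 0) :
    (gaussianVector n).map (fun X => (a ⬝ᵥ X, b ⬝ᵥ X, c ⬝ᵥ X))
      = (gaussianReal 0 1).prod ((gaussianReal 0 1).prod (gaussianReal 0 1)) := by
  have hba : b ⬝ᵥ a = 0 := by rw [dotProduct_comm, hab]
  have hca : c ⬝ᵥ a = 0 := by rw [dotProduct_comm, hac]
  have hcb : c ⬝ᵥ b = 0 := by rw [dotProduct_comm, hbc]
  have h := gaussianVector_map_mulVec (Matrix.of ![a, b, c]) (by
    ext i j
    change ![a, b, c] i ⬝ᵥ ![a, b, c] j = _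
    fin_cases i <;> fin_cases j <;>
      first
      | simpa using haa
      | simpa using hab
      | simpa using hac
      | simpa using hba
      | simpa using hbb
      | simpa using hbc
      | simpa using hca
      | simpa using hcb
      | simpa using hcc)
  have h2 := ((MeasurePreserving.id (gaussianReal 0 1)).prod
    (measurePreserving_finTwoArrow (gaussianReal 0 1))).comp
      (measurePreserving_piFinSuccAbove (fun _ : Fin 3 => gaussianReal 0 1) 0)
  have h4 := h2.map_eq
  have h3 : gaussianVector 3 = Measure.pi fun _ => gaussianReal 0 1 := rfl
  rw [← h3, ← h, Measure.map_map h2.measurable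
    (measurable_mulVec_left _)] at h4
  rw [← h4]
  rfl

theorem setOf_abs_affine_le {c d t : ℝ} (hd : 0 < d) :
    {y : ℝ | |c + d * y| ≤ t} = Set.Icc ((-t - c) / d) ((t - c) / d) := by
  ext y
  rw [Set.mem_ofPred_eq, abs_le, Set.mem_Icc, div_le_iff₀ hd, le_div_iff₀ hd]
  constructor <;> rintro ⟨h1, h2⟩ <;> constructor <;> linarith

/-- The upper bound is uniform in the centre `c`, as the Gaussian density is at most
`1 / √(2π)`. -/
theorem gaussianReal_abs_affine_le (c t : ℝ) {d : ℝ} (hd : 0 < d) :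
    gaussianReal 0 1 {y | |c + d * y| ≤ t} ≤ ENNReal.ofReal (2 * t / (d * √(2 * Real.pi))) := by
  rw [setOf_abs_affine_le hd, gaussianReal_apply _ one_ne_zero]
  have hpdf : ∀ y, gaussianPDF 0 1 y ≤ ENNReal.ofReal (1 / √(2 * Real.pi)) := by
    intro y
    refine ENNReal.ofReal_le_ofReal ?_
    rw [gaussianPDFReal_def]
    simp only [NNReal.coe_one, mul_one, one_div]
    refine mul_le_of_le_one_right (by positivity) (Real.exp_le_one_iff.2 ?_)
    have := sq_nonneg (y - 0)
    linarith
  calc _ ≤ ∫⁻ _ in Set.Icc ((-t - c) / d) ((t - c) / d), ENNReal.ofReal (1 / √(2 * Real.pi)) :=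
        lintegral_mono hpdf
    _ = _ := by
      rw [setLIntegral_const, Real.volume_Icc, ← ENNReal.ofReal_mul (by positivity)]
      congr 1; field_simp; ring

theorem le_gaussianReal_abs_affine (c : ℝ) {d t : ℝ} (hd : 0 < d) :
    ENNReal.ofReal (2 * t / (d * √(2 * Real.pi)) * Real.exp (-((|c| + t) / d) ^ 2 / 2))
      ≤ gaussianReal 0 1 {y | |c + d * y| ≤ t} := by
  rw [setOf_abs_affine_le hd, gaussianReal_apply _ one_ne_zero]
  have hpdf : ∀ y ∈ Set.Icc ((-t - c) / d) ((t - c) / d),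
      ENNReal.ofReal (1 / √(2 * Real.pi) * Real.exp (-((|c| + t) / d) ^ 2 / 2))
        ≤ gaussianPDF 0 1 y := by
    intro y hy
    refine ENNReal.ofReal_le_ofReal ?_
    rw [gaussianPDFReal_def]
    simp only [NNReal.coe_one, mul_one, one_div, sub_zero]
    refine mul_le_mul_of_nonneg_left (Real.exp_le_exp.2 ?_) (by positivity)
    have hy2 : y ^ 2 ≤ ((|c| + t) / d) ^ 2 := ?_
    · linarith
    rw [← setOf_abs_affine_le hd, Set.mem_ofPred_eq, abs_le] at hy
    refine sq_le_sq' (a := y) ?_ ?_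
    · rw [← neg_div, div_le_iff₀ hd]; linarith [le_abs_self c]
    · rw [le_div_iff₀ hd]; linarith [neg_abs_le c]
  calc _ = ∫⁻ _ in Set.Icc ((-t - c) / d) ((t - c) / d),
        ENNReal.ofReal (1 / √(2 * Real.pi) * Real.exp (-((|c| + t) / d) ^ 2 / 2)) := by
        rw [setLIntegral_const, Real.volume_Icc, ← ENNReal.ofReal_mul (by positivity)]
        congr 1; field_simp; ring
    _ ≤ _ := setLIntegral_mono' measurableSet_Icc hpdf

/-- Cavalieri-type bound for the part of `E` above `I`, from a uniform bound on the sections. -/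
theorem prod_le_mul_of_section_le {α β : Type*} [MeasurableSpace α] [MeasurableSpace β]
    {μ : Measure α} {ν : Measure β} [SFinite ν] {I : Set α} {E : Set (α × β)}
    (hI : MeasurableSet I) (hE : MeasurableSet E) {u : ENNReal}
    (h : ∀ a ∈ I, ν (Prod.mk a ⁻¹' E) ≤ u) :
    μ.prod ν ((I ×ˢ Set.univ) ∩ E) ≤ μ I * u := by
  rw [Measure.prod_apply ((hI.prod .univ).inter hE), ← setLIntegral_one,
    ← lintegral_mul_const _ measurable_const, ← lintegral_indicator hI]
  refine lintegral_mono fun a => ?_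
  by_cases ha : a ∈ I
  · simpa [ha, Set.preimage_inter] using h a ha
  · simp [ha]

theorem mul_le_prod_of_le_section {α β : Type*} [MeasurableSpace α] [MeasurableSpace β]
    {μ : Measure α} {ν : Measure β} [SFinite ν] {I : Set α} {E : Set (α × β)}
    (hI : MeasurableSet I) (hE : MeasurableSet E) {u : ENNReal}
    (h : ∀ a ∈ I, u ≤ ν (Prod.mk a ⁻¹' E)) :
    μ I * u ≤ μ.prod ν ((I ×ˢ Set.univ) ∩ E) := by
  rw [Measure.prod_apply ((hI.prod .univ).inter hE), ← setLIntegral_one,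
    ← lintegral_mul_const _ measurable_const, ← lintegral_indicator hI]
  refine lintegral_mono fun a => ?_
  by_cases ha : a ∈ I
  · simpa [ha, Set.preimage_inter] using h a ha
  · simp [ha]

section Conditioning

variable {Ω β : Type*} [MeasurableSpace Ω] [MeasurableSpace β] {P : Measure Ω}
  {μ : Measure ℝ} {ν : Measure β}
  [IsProbabilityMeasure ν] {A : Ω → ℝ} {B : Ω → β} {I : Set ℝ} {E : Set (ℝ × β)} {u : ENNReal}

theorem cond_preimage_eq (hA : Measurable A) (hB : Measurable B)
    (hAB : P.map (fun ω => (A ω, B ω)) = μ.prod ν) (hI : MeasurableSet I)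
    (hE : MeasurableSet E) :
    P[|A ⁻¹' I] {ω | (A ω, B ω) ∈ E} = (μ I)⁻¹ * μ.prod ν ((I ×ˢ Set.univ) ∩ E) := by
  have h1 : P (A ⁻¹' I) = μ I := by
    have : A ⁻¹' I = (fun ω => (A ω, B ω)) ⁻¹' (I ×ˢ Set.univ) := by ext; simp
    rw [this, ← Measure.map_apply (hA.prodMk hB) (hI.prod .univ), hAB, Measure.prod_prod,
      measure_univ, mul_one]
  rw [cond_apply (hA hI), h1, ← hAB,
    Measure.map_apply (hA.prodMk hB) ((hI.prod .univ).inter hE)]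
  congr 2
  ext; simp

/-- If `A` and `B` are independent, then conditioning on `A ∈ I` averages the probabilities of the
sections of `E` over `a ∈ I`, so a uniform bound on these is inherited. -/
theorem cond_le_of_section_le (hA : Measurable A) (hB : Measurable B)
    (hAB : P.map (fun ω => (A ω, B ω)) = μ.prod ν) (hI : MeasurableSet I)
    (hE : MeasurableSet E) (hI0 : μ I ≠ 0) (hI1 : μ I ≠ ⊤) (h : ∀ a ∈ I, ν (Prod.mk a ⁻¹' E) ≤ u) :
    P[|A ⁻¹' I] {ω | (A ω, B ω) ∈ E} ≤ u := by
  rw [cond_preimage_eq hA hB hAB hI hE]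
  calc _ ≤ (μ I)⁻¹ * (μ I * u) := by gcongr; exact prod_le_mul_of_section_le hI hE h
    _ = u := by rw [← mul_assoc, ENNReal.inv_mul_cancel hI0 hI1, one_mul]

theorem le_cond_of_le_section (hA : Measurable A) (hB : Measurable B)
    (hAB : P.map (fun ω => (A ω, B ω)) = μ.prod ν) (hI : MeasurableSet I)
    (hE : MeasurableSet E) (hI0 : μ I ≠ 0) (hI1 : μ I ≠ ⊤) (h : ∀ a ∈ I, u ≤ ν (Prod.mk a ⁻¹' E)) :
    u ≤ P[|A ⁻¹' I] {ω | (A ω, B ω) ∈ E} := by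
  rw [cond_preimage_eq hA hB hAB hI hE]
  calc u = (μ I)⁻¹ * (μ I * u) := by
        rw [← mul_assoc, ENNReal.inv_mul_cancel hI0 hI1, one_mul]
    _ ≤ _ := by gcongr; exact mul_le_prod_of_le_section hI hE h

end Conditioning

/-! ### Small-ball estimates under the planted measure -/

/-- The unit vector `σ / √n`. -/
noncomputable def dir {n : ℕ} (σ : Spin n) : Fin n → ℝ := fun i => ((σ i : ℤ) : ℝ) / √(n : ℝ)

theorem hamiltonian_eq_abs_dir {n : ℕ} (X : Fin n → ℝ) (σ : Spin n) :
    hamiltonian X σ = |dir σ ⬝ᵥ X| := by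
  have : dir σ ⬝ᵥ X = overlap σ X / √(n : ℝ) := by
    simp only [dir, dotProduct, overlap, Finset.sum_div]
    exact Finset.sum_congr rfl fun i _ => by ring
  rw [this, hamiltonian, abs_div, abs_of_nonneg (Real.sqrt_nonneg _)]

theorem dir_dot_dir {n : ℕ} (σ τ : Spin n) :
    dir σ ⬝ᵥ dir τ = (∑ i, ((σ i : ℤ) : ℝ) * ((τ i : ℤ) : ℝ)) / n := by
  simp only [dir, dotProduct, Finset.sum_div]
  refine Finset.sum_congr rfl fun i _ => ?_
  rw [div_mul_div_comm, Real.mul_self_sqrt (Nat.cast_nonneg _)]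

theorem spin_mul_self {n : ℕ} (σ : Spin n) (i : Fin n) :
    ((σ i : ℤ) : ℝ) * ((σ i : ℤ) : ℝ) = 1 := by
  rcases Int.units_eq_one_or (σ i) with h | h <;> simp [h]

theorem dir_dot_self {n : ℕ} (hn : 0 < n) (σ : Spin n) : dir σ ⬝ᵥ dir σ = 1 := by
  have : (n : ℝ) ≠ 0 := by positivity
  rw [dir_dot_dir]
  simp [spin_mul_self, this]

theorem measurable_dot {n : ℕ} (a : Fin n → ℝ) : Measurable fun X : Fin n → ℝ => a ⬝ᵥ X := by
  unfold dotProduct; fun_prop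

theorem plantedMeasure_eq_cond {n : ℕ} (σs : Spin n) :
    plantedMeasure σs = (gaussianVector n)[|(fun X : Fin n → ℝ => dir σs ⬝ᵥ X) ⁻¹'
      {y | |y| ≤ ((3 : ℝ) ^ n)⁻¹}] := by
  simp only [plantedMeasure, hamiltonian_eq_abs_dir]
  rfl

theorem measurableSet_abs_le (ε : ℝ) : MeasurableSet {y : ℝ | |y| ≤ ε} :=
  measurableSet_le (by fun_prop) measurable_const

theorem gaussianReal_abs_le_ne_zero {ε : ℝ} (hε : 0 < ε) :
    gaussianReal 0 1 {y : ℝ | |y| ≤ ε} ≠ 0 := by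
  have h := le_gaussianReal_abs_affine 0 (t := ε) one_pos
  simp only [zero_add, one_mul] at h
  refine ((ENNReal.ofReal_pos.2 ?_).trans_le h).ne'
  positivity

/-- The length `2t` of an interval times the maximal density of a Gaussian of standard deviation
`s`: an upper bound for the probability of the interval. -/
noncomputable def ballBound (s t : ℝ) : ℝ := 2 * t / (s * √(2 * Real.pi))

theorem ballBound_nonneg {s t : ℝ} (hs : 0 ≤ s) (ht : 0 ≤ t) : 0 ≤ ballBound s t := by
  unfold ballBound; positivity

theorem ballBound_pos {s t : ℝ} (hs : 0 < s) (ht : 0 < t) : 0 < ballBound s t := by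
  unfold ballBound; positivity

section Single

variable {n : ℕ} {σs σ : Spin n} {s : ℝ}

/-- Gram–Schmidt: `σ / √n` as a combination of `σ* / √n` and a unit vector orthogonal to it. -/
theorem exists_orthogonal_direction (hn : 0 < n) (hs : 0 < s)
    (hms : (dir σs ⬝ᵥ dir σ) ^ 2 + s ^ 2 = 1) :
    ∃ b : Fin n → ℝ, dir σs ⬝ᵥ b = 0 ∧ b ⬝ᵥ b = 1 ∧
      dir σ = (dir σs ⬝ᵥ dir σ) • dir σs + s • b := by
  set m := dir σs ⬝ᵥ dir σ with hm
  have haa := dir_dot_self hn σs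
  have hvv := dir_dot_self hn σ
  have hva : dir σ ⬝ᵥ dir σs = m := by rw [dotProduct_comm]
  refine ⟨s⁻¹ • (dir σ - m • dir σs), ?_, ?_, ?_⟩
  · simp only [dotProduct_smul, dotProduct_sub, haa, smul_eq_mul, ← hm]
    ring
  · simp only [dotProduct_smul, smul_dotProduct, dotProduct_sub, sub_dotProduct, haa, hvv, hva,
      smul_eq_mul, ← hm]
    field_simp
    linarith
  · rw [smul_smul, mul_inv_cancel₀ hs.ne', one_smul]
    abel

theorem setOf_hamiltonian_le_eq {b : Fin n → ℝ} {m t : ℝ} (hv : dir σ = m • dir σs + s • b) :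
    {X | hamiltonian X σ ≤ t} = {X | ((fun X => dir σs ⬝ᵥ X) X, (fun X => b ⬝ᵥ X) X) ∈
      {p : ℝ × ℝ | |m * p.1 + s * p.2| ≤ t}} := by
  ext X
  simp only [Set.mem_ofPred_eq, hamiltonian_eq_abs_dir]
  rw [hv, add_dotProduct, smul_dotProduct, smul_dotProduct, smul_eq_mul, smul_eq_mul]

theorem planted_small_ball_le (hn : 0 < n) (hs : 0 < s)
    (hms : (dir σs ⬝ᵥ dir σ) ^ 2 + s ^ 2 = 1) (t : ℝ) :
    plantedMeasure σs {X | hamiltonian X σ ≤ t} ≤ ENNReal.ofReal (ballBound s t) := by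
  obtain ⟨b, hab, hbb, hv⟩ := exists_orthogonal_direction hn hs hms
  rw [plantedMeasure_eq_cond, setOf_hamiltonian_le_eq hv]
  exact cond_le_of_section_le (measurable_dot _) (measurable_dot _)
    (gaussianVector_map_pair (dir_dot_self hn σs) hbb hab) (measurableSet_abs_le _)
    (measurableSet_le (by fun_prop) measurable_const)
    (gaussianReal_abs_le_ne_zero (by positivity)) (measure_ne_top _ _)
    fun x _ => gaussianReal_abs_affine_le ((dir σs ⬝ᵥ dir σ) * x) t hs

theorem le_planted_small_ball (hn : 0 < n) (hs : 0 < s)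
    (hms : (dir σs ⬝ᵥ dir σ) ^ 2 + s ^ 2 = 1) {t : ℝ} (ht : 0 ≤ t) :
    ENNReal.ofReal (ballBound s t * Real.exp (-((((3 : ℝ) ^ n)⁻¹ + t) / s) ^ 2 / 2))
      ≤ plantedMeasure σs {X | hamiltonian X σ ≤ t} := by
  obtain ⟨b, hab, hbb, hv⟩ := exists_orthogonal_direction hn hs hms
  rw [plantedMeasure_eq_cond, setOf_hamiltonian_le_eq hv]
  refine le_cond_of_le_section (measurable_dot _) (measurable_dot _)
    (gaussianVector_map_pair (dir_dot_self hn σs) hbb hab) (measurableSet_abs_le _)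
    (measurableSet_le (by fun_prop) measurable_const)
    (gaussianReal_abs_le_ne_zero (by positivity)) (measure_ne_top _ _)
    fun x hx => le_trans ?_ (le_gaussianReal_abs_affine ((dir σs ⬝ᵥ dir σ) * x) hs)
  have hm1 : |dir σs ⬝ᵥ dir σ| ≤ 1 := by
    rw [← sq_le_one_iff_abs_le_one]; nlinarith
  have hx' : |(dir σs ⬝ᵥ dir σ) * x| ≤ ((3 : ℝ) ^ n)⁻¹ := by
    rw [abs_mul]
    exact (mul_le_of_le_one_left (abs_nonneg _) hm1).trans hx
  refine ENNReal.ofReal_le_ofReal (mul_le_mul_of_nonneg_left (Real.exp_le_exp.2 ?_)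
    (ballBound_nonneg hs.le ht))
  have : ((|(dir σs ⬝ᵥ dir σ) * x| + t) / s) ^ 2 ≤ ((((3 : ℝ) ^ n)⁻¹ + t) / s) ^ 2 := by
    gcongr
  linarith

/-- Two-spin version of `planted_small_ball_le`: after Gram–Schmidt, conditioning on the planted
coordinate and then on the second one leaves a Gaussian of standard deviation `s √(1 - r²)`. -/
theorem planted_small_ball_pair_le {τ : Spin n} {r q : ℝ} (hn : 0 < n) (hs : 0 < s)
    (hms : (dir σs ⬝ᵥ dir σ) ^ 2 + s ^ 2 = 1) (hτ : dir σs ⬝ᵥ dir τ = dir σs ⬝ᵥ dir σ)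
    (hστ : dir σ ⬝ᵥ dir τ = (dir σs ⬝ᵥ dir σ) ^ 2 + s ^ 2 * r) (hq : 0 < q)
    (hqr : q ^ 2 = 1 - r ^ 2) (t : ℝ) :
    plantedMeasure σs ({X | hamiltonian X σ ≤ t} ∩ {X | hamiltonian X τ ≤ t})
      ≤ ENNReal.ofReal (ballBound s t) * ENNReal.ofReal (ballBound (s * q) t) := by
  obtain ⟨b, hab, hbb, hv⟩ := exists_orthogonal_direction hn hs hms
  have haa := dir_dot_self hn σs
  have hww := dir_dot_self hn τ
  set m := dir σs ⬝ᵥ dir σ with hm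
  have hτ' : dir τ ⬝ᵥ dir σs = m := by rw [dotProduct_comm, hτ]
  have hba : b ⬝ᵥ dir σs = 0 := by rw [dotProduct_comm, hab]
  have hbw : b ⬝ᵥ dir τ = s * r := by
    rw [hv, add_dotProduct, smul_dotProduct, smul_dotProduct, hτ, smul_eq_mul, smul_eq_mul] at hστ
    have : s * (b ⬝ᵥ dir τ) = s * (s * r) := by linear_combination hστ
    exact mul_left_cancel₀ hs.ne' this
  have hwb : dir τ ⬝ᵥ b = s * r := by rw [dotProduct_comm, hbw]
  obtain ⟨c, hac, hbc, hcc, hw⟩ : ∃ c : Fin n → ℝ, dir σs ⬝ᵥ c = 0 ∧ b ⬝ᵥ c = 0 ∧ c ⬝ᵥ c = 1 ∧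
      dir τ = m • dir σs + (s * r) • b + (s * q) • c := by
    have hsq : s * q ≠ 0 := (mul_pos hs hq).ne'
    refine ⟨(s * q)⁻¹ • (dir τ - m • dir σs - (s * r) • b), ?_, ?_, ?_, ?_⟩
    · simp only [dotProduct_smul, dotProduct_sub, haa, hab, hτ, smul_eq_mul]
      ring
    · simp only [dotProduct_smul, dotProduct_sub, hba, hbb, hbw, smul_eq_mul]
      ring
    · simp only [dotProduct_smul, smul_dotProduct, dotProduct_sub, sub_dotProduct, haa, hab, hba,
        hbb, hbw, hwb, hτ, hτ', hww, smul_eq_mul]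
      field_simp
      linear_combination (-1 : ℝ) * hms - s ^ 2 * hqr
    · rw [smul_smul, mul_inv_cancel₀ hsq, one_smul]
      abel
  have hset : {X | hamiltonian X σ ≤ t} ∩ {X | hamiltonian X τ ≤ t}
      = {X | ((fun X => dir σs ⬝ᵥ X) X, (fun X => (b ⬝ᵥ X, c ⬝ᵥ X)) X) ∈
        {p : ℝ × ℝ × ℝ | |m * p.1 + s * p.2.1| ≤ t} ∩
        {p : ℝ × ℝ × ℝ | |m * p.1 + s * r * p.2.1 + s * q * p.2.2| ≤ t}} := by
    ext X
    simp only [Set.mem_ofPred_eq, Set.mem_inter_iff, hamiltonian_eq_abs_dir]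
    rw [hw, hv, add_dotProduct, add_dotProduct, add_dotProduct, smul_dotProduct, smul_dotProduct,
      smul_dotProduct, smul_dotProduct]
    simp only [smul_eq_mul]
  rw [plantedMeasure_eq_cond, hset]
  refine cond_le_of_section_le (measurable_dot _)
    ((measurable_dot _).prodMk (measurable_dot _))
    (gaussianVector_map_triple haa hbb hcc hab hac hbc) (measurableSet_abs_le _)
    ((measurableSet_le (by fun_prop) measurable_const).inter
      (measurableSet_le (by fun_prop) measurable_const))
    (gaussianReal_abs_le_ne_zero (by positivity)) (measure_ne_top _ _) fun x _ => ?_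
  have hsec : Prod.mk x ⁻¹' ({p : ℝ × ℝ × ℝ | |m * p.1 + s * p.2.1| ≤ t} ∩
        {p : ℝ × ℝ × ℝ | |m * p.1 + s * r * p.2.1 + s * q * p.2.2| ≤ t})
      = ({y : ℝ | |m * x + s * y| ≤ t} ×ˢ Set.univ) ∩
        {p : ℝ × ℝ | |m * x + s * r * p.1 + s * q * p.2| ≤ t} := by
    ext p; simp
  rw [hsec]
  calc _ ≤ gaussianReal 0 1 {y : ℝ | |m * x + s * y| ≤ t}
        * ENNReal.ofReal (ballBound (s * q) t) :=
        prod_le_mul_of_section_le (measurableSet_le (by fun_prop) measurable_const)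
          (measurableSet_le (by fun_prop) measurable_const)
          fun y _ => gaussianReal_abs_affine_le (m * x + s * r * y) t (mul_pos hs hq)
    _ ≤ _ := by
        gcongr
        exact gaussianReal_abs_affine_le _ t hs

end Single

theorem isProbabilityMeasure_plantedMeasure {n : ℕ} (hn : 0 < n) (σs : Spin n) :
    IsProbabilityMeasure (plantedMeasure σs) := by
  rw [plantedMeasure_eq_cond]
  refine cond_isProbabilityMeasure ?_
  have hmap : (gaussianVector n).map (fun X => dir σs ⬝ᵥ X) = gaussianReal 0 1 := by
    have h := gaussianVector_map_mulVec (Matrix.of fun _ : Fin 1 => dir σs) (by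
      ext i j
      change dir σs ⬝ᵥ dir σs = _
      rw [dir_dot_self hn, Subsingleton.elim i j, Matrix.one_apply_eq])
    have h2 := measurePreserving_eval (fun _ : Fin 1 => gaussianReal 0 1) 0
    rw [← h2.map_eq, ← show gaussianVector 1 = Measure.pi fun _ => gaussianReal 0 1 from rfl, ← h,
      Measure.map_map h2.measurable (measurable_mulVec_left _)]
    rfl
  rw [← Measure.map_apply (measurable_dot _) (measurableSet_abs_le _), hmap]
  exact gaussianReal_abs_le_ne_zero (by positivity)

/-! ### The second moment method -/

/-- The second moment method, from the pointwise inequality `1_{M = 0} ≤ (1 - M / e)²` for the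
number `M` of events that occur. -/
theorem measureReal_none_le {Ω ι : Type*} [MeasurableSpace Ω] (P : Measure Ω)
    [IsProbabilityMeasure P] (F : Finset ι) {E : ι → Set Ω} (hE : ∀ i, MeasurableSet (E i))
    {e : ℝ} (he : 0 < e) :
    P.real {ω | ∀ i ∈ F, ω ∉ E i} ≤ 1 - 2 / e * ∑ i ∈ F, P.real (E i)
      + 1 / e ^ 2 * ∑ i ∈ F, ∑ j ∈ F, P.real (E i ∩ E j) := by
  have hset : MeasurableSet {ω | ∀ i ∈ F, ω ∉ E i} := by
    have : {ω | ∀ i ∈ F, ω ∉ E i} = ⋂ i ∈ F, (E i)ᶜ := by ext; simp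
    rw [this]
    exact F.measurableSet_biInter fun i _ => (hE i).compl
  have hint : ∀ A : Set Ω, MeasurableSet A → Integrable (A.indicator (1 : Ω → ℝ)) P :=
    fun A hA => (integrable_const (1 : ℝ)).indicator hA
  have h1 : Integrable (fun ω => ∑ i ∈ F, (E i).indicator (1 : Ω → ℝ) ω) P :=
    integrable_finsetSum _ fun i _ => hint _ (hE i)
  have h2 : Integrable (fun ω => ∑ i ∈ F, ∑ j ∈ F, (E i ∩ E j).indicator (1 : Ω → ℝ) ω) P :=
    integrable_finsetSum _ fun i _ => integrable_finsetSum _ fun j _ =>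
      hint _ ((hE i).inter (hE j))
  have hint2 : Integrable (fun ω => 1 - 2 / e * ∑ i ∈ F, (E i).indicator (1 : Ω → ℝ) ω
      + 1 / e ^ 2 * ∑ i ∈ F, ∑ j ∈ F, (E i ∩ E j).indicator (1 : Ω → ℝ) ω) P :=
    ((integrable_const _).sub (h1.const_mul _)).add (h2.const_mul _)
  have hval : ∫ ω, (1 - 2 / e * ∑ i ∈ F, (E i).indicator (1 : Ω → ℝ) ω
      + 1 / e ^ 2 * ∑ i ∈ F, ∑ j ∈ F, (E i ∩ E j).indicator (1 : Ω → ℝ) ω) ∂P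
      = 1 - 2 / e * ∑ i ∈ F, P.real (E i)
      + 1 / e ^ 2 * ∑ i ∈ F, ∑ j ∈ F, P.real (E i ∩ E j) := by
    rw [integral_add (f := fun ω => 1 - 2 / e * ∑ i ∈ F, (E i).indicator (1 : Ω → ℝ) ω)
        ((integrable_const _).sub (h1.const_mul _)) (h2.const_mul _),
      integral_sub (integrable_const _) (h1.const_mul _), integral_const_mul, integral_const_mul,
      integral_finsetSum _ fun i _ => hint _ (hE i),
      integral_finsetSum _ fun i _ => integrable_finsetSum _ fun j _ =>
        hint _ ((hE i).inter (hE j))]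
    congr 1
    · simp [integral_indicator_one, hE]
    · congr 1
      refine Finset.sum_congr rfl fun i _ => ?_
      rw [integral_finsetSum _ fun j _ => hint _ ((hE i).inter (hE j))]
      exact Finset.sum_congr rfl fun j _ => integral_indicator_one ((hE i).inter (hE j))
  rw [← hval, ← integral_indicator_one hset]
  refine integral_mono (hint _ hset) hint2 fun ω => ?_
  set M := ∑ i ∈ F, (E i).indicator (1 : Ω → ℝ) ω with hM
  have hMM : ∑ i ∈ F, ∑ j ∈ F, (E i ∩ E j).indicator (1 : Ω → ℝ) ω = M ^ 2 := by
    rw [sq, hM, Finset.sum_mul_sum]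
    simp [Set.inter_indicator_one]
  have hR : 1 - 2 / e * M + 1 / e ^ 2 * M ^ 2 = (1 - M / e) ^ 2 := by
    field_simp; ring
  simp only [hMM, hR]
  by_cases hω : ω ∈ {ω | ∀ i ∈ F, ω ∉ E i}
  · have : M = 0 := Finset.sum_eq_zero fun i hi => Set.indicator_of_notMem (hω i hi) _
    simp [this, Set.indicator_of_mem hω]
  · rw [Set.indicator_of_notMem hω]
    positivity

/-! ### Spins at a given distance as `k`-subsets -/

/-- The spin obtained from `σ` by flipping the signs of the coordinates in `S`. -/
def flip {n : ℕ} (σ : Spin n) (S : Finset (Fin n)) : Spin n :=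
  fun i => if i ∈ S then -σ i else σ i

theorem mem_sphere_iff {n k : ℕ} (hk : 0 < k) (hkn : k < n) (σs σ : Spin n) :
    σ ∈ sphere σs k ↔ ∃ S ∈ (Finset.univ : Finset (Fin n)).powersetCard k, flip σs S = σ := by
  have hne : ∀ u : ℤˣ, -u ≠ u := by decide
  have hd : ∀ S : Finset (Fin n), hammingDist (flip σs S) σs = S.card := by
    intro S
    rw [hammingDist]
    congr 1
    ext i
    by_cases hi : i ∈ S <;> simp [flip, hi, hne]
  constructor
  · rintro ⟨-, -, h⟩
    refine ⟨Finset.univ.filter fun i => σ i ≠ σs i, Finset.mem_powersetCard_univ.2 h, ?_⟩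
    ext1 i
    by_cases hi : σ i = σs i
    · simp [flip, hi]
    · simp [flip, Int.units_ne_iff_eq_neg.1 hi]
  · rintro ⟨S, hS, rfl⟩
    rw [Finset.mem_powersetCard_univ] at hS
    have hdS := hd S
    refine ⟨fun h => ?_, fun h => ?_, hdS.trans hS⟩
    · rw [h, hammingDist_self] at hdS
      omega
    · have hall : hammingDist (-σs) σs = n := by simp [hammingDist, hne]
      rw [h, hall] at hdS
      omega

theorem dir_dot_flip_flip {n k : ℕ} (hn : 0 < n) (σs : Spin n) {S T : Finset (Fin n)}
    (hS : S.card = k) (hT : T.card = k) :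
    dir (flip σs S) ⬝ᵥ dir (flip σs T) = 1 - 4 * (k : ℝ) / n + 4 * ((S ∩ T).card : ℝ) / n := by
  have hn' : (0 : ℝ) < n := by exact_mod_cast hn
  have h : ∀ i, ((flip σs S i : ℤ) : ℝ) * ((flip σs T i : ℤ) : ℝ)
      = 1 - 2 * (if i ∈ S then (1 : ℝ) else 0) - 2 * (if i ∈ T then (1 : ℝ) else 0)
        + 4 * (if i ∈ S ∩ T then (1 : ℝ) else 0) := by
    intro i
    have := spin_mul_self σs i
    by_cases h1 : i ∈ S <;> by_cases h2 : i ∈ T <;> simp [flip, h1, h2, this] <;> norm_num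
  rw [dir_dot_dir]
  simp only [h, Finset.sum_add_distrib, Finset.sum_sub_distrib, ← Finset.mul_sum,
    Finset.sum_ite_mem, Finset.univ_inter, Finset.sum_const, hS, hT, Finset.card_univ,
    Fintype.card_fin, nsmul_eq_mul, mul_one]
  field_simp
  ring

theorem dir_dot_flip {n k : ℕ} (hn : 0 < n) (σs : Spin n) {S : Finset (Fin n)}
    (hS : S.card = k) : dir σs ⬝ᵥ dir (flip σs S) = 1 - 2 * ((k : ℝ) / n) := by
  have hn' : (0 : ℝ) < n := by exact_mod_cast hn
  have h : ∀ i, ((σs i : ℤ) : ℝ) * ((flip σs S i : ℤ) : ℝ)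
      = 1 - 2 * (if i ∈ S then (1 : ℝ) else 0) := by
    intro i
    have := spin_mul_self σs i
    by_cases h1 : i ∈ S <;> simp [flip, h1, this]
    norm_num
  rw [dir_dot_dir]
  simp only [h, Finset.sum_sub_distrib, ← Finset.mul_sum, Finset.sum_ite_mem, Finset.univ_inter,
    Finset.sum_const, hS, Finset.card_univ, Fintype.card_fin, nsmul_eq_mul, mul_one]
  field_simp

/-- The standard deviation of `n^{-1/2} ⟨σ, X⟩` given `⟨σ*, X⟩`, for `σ` at distance `κ n`. -/
noncomputable def residualSD (κ : ℝ) : ℝ := 2 * √(κ * (1 - κ))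

theorem residualSD_pos {κ : ℝ} (h0 : 0 < κ) (h1 : κ < 1) : 0 < residualSD κ :=
  mul_pos two_pos (Real.sqrt_pos.2 (mul_pos h0 (sub_pos.2 h1)))

theorem residualSD_sq {κ : ℝ} (h0 : 0 < κ) (h1 : κ < 1) :
    residualSD κ ^ 2 = 4 * (κ * (1 - κ)) := by
  rw [residualSD, mul_pow, Real.sq_sqrt (mul_pos h0 (sub_pos.2 h1)).le]
  norm_num

section Fixed

variable {n k : ℕ} {σs : Spin n} {S T : Finset (Fin n)}

theorem ratio_pos (hk : 0 < k) (hkn : k < n) : 0 < (k : ℝ) / n :=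
  div_pos (by exact_mod_cast hk) (by exact_mod_cast hk.trans hkn)

theorem ratio_lt_one (hk : 0 < k) (hkn : k < n) : (k : ℝ) / n < 1 :=
  (div_lt_one (by exact_mod_cast hk.trans hkn)).2 (by exact_mod_cast hkn)

theorem dir_flip_residual (hk : 0 < k) (hkn : k < n) (hS : S.card = k) :
    (dir σs ⬝ᵥ dir (flip σs S)) ^ 2 + residualSD ((k : ℝ) / n) ^ 2 = 1 := by
  rw [residualSD_sq (ratio_pos hk hkn) (ratio_lt_one hk hkn), dir_dot_flip (hk.trans hkn) σs hS]
  ring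

theorem planted_flip_le (hk : 0 < k) (hkn : k < n) (hS : S.card = k) {t : ℝ} (ht : 0 ≤ t) :
    (plantedMeasure σs).real {X | hamiltonian X (flip σs S) ≤ t}
      ≤ ballBound (residualSD ((k : ℝ) / n)) t := by
  have hs := residualSD_pos (ratio_pos hk hkn) (ratio_lt_one hk hkn)
  exact ENNReal.toReal_le_of_le_ofReal (ballBound_nonneg hs.le ht)
    (planted_small_ball_le (hk.trans hkn) hs (dir_flip_residual hk hkn hS) t)

theorem le_planted_flip (hk : 0 < k) (hkn : k < n) (hS : S.card = k) {t : ℝ} (ht : 0 ≤ t) :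
    ballBound (residualSD ((k : ℝ) / n)) t *
        Real.exp (-((((3 : ℝ) ^ n)⁻¹ + t) / residualSD ((k : ℝ) / n)) ^ 2 / 2)
      ≤ (plantedMeasure σs).real {X | hamiltonian X (flip σs S) ≤ t} := by
  have := isProbabilityMeasure_plantedMeasure (hk.trans hkn) σs
  exact (ENNReal.ofReal_le_iff_le_toReal (measure_ne_top _ _)).1
    (le_planted_small_ball (hk.trans hkn)
      (residualSD_pos (ratio_pos hk hkn) (ratio_lt_one hk hkn)) (dir_flip_residual hk hkn hS) ht)

/-- For `T ≠ S, Sᶜ` the pair density factor `(1 - r²)^{-1/2}` exceeds `1` by at most `√n r²`. -/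
theorem planted_flip_pair_le (hk : 0 < k) (hkn : k < n) (hS : S.card = k) (hT : T.card = k)
    (h1 : T ≠ S) (h2 : T ≠ Sᶜ) {t : ℝ} (ht : 0 ≤ t) :
    (plantedMeasure σs).real ({X | hamiltonian X (flip σs S) ≤ t} ∩
        {X | hamiltonian X (flip σs T) ≤ t})
      ≤ ballBound (residualSD ((k : ℝ) / n)) t ^ 2 *
        (1 + √(n : ℝ) * setCorr n k (S ∩ T).card ^ 2) := by
  have hn := hk.trans hkn
  have hn' : (0 : ℝ) < n := by exact_mod_cast hn
  have hk' : (0 : ℝ) < k := by exact_mod_cast hk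
  have hkn' : (0 : ℝ) < (n : ℝ) - k := by rw [sub_pos]; exact_mod_cast hkn
  have hs := residualSD_pos (ratio_pos hk hkn) (ratio_lt_one hk hkn)
  set s := residualSD ((k : ℝ) / n) with hs_def
  set r := setCorr n k (S ∩ T).card with hr
  have hr2 : r ^ 2 ≤ 1 - 1 / n := setCorr_sq_le hk hkn hS hT h1 h2
  have hinv : (0 : ℝ) < 1 / n := by positivity
  have hq : 0 < √(1 - r ^ 2) := Real.sqrt_pos.2 (by linarith)
  have hqr : √(1 - r ^ 2) ^ 2 = 1 - r ^ 2 := Real.sq_sqrt (by linarith)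
  have hcorr : dir (flip σs S) ⬝ᵥ dir (flip σs T)
      = (dir σs ⬝ᵥ dir (flip σs S)) ^ 2 + s ^ 2 * r := by
    rw [dir_dot_flip_flip hn σs hS hT, dir_dot_flip hn σs hS, hs_def,
      residualSD_sq (ratio_pos hk hkn) (ratio_lt_one hk hkn), hr, setCorr]
    field_simp
    ring
  have h := planted_small_ball_pair_le hn hs (dir_flip_residual hk hkn hS)
    ((dir_dot_flip hn σs hT).trans (dir_dot_flip hn σs hS).symm) hcorr hq hqr t
  rw [← ENNReal.ofReal_mul (ballBound_nonneg hs.le ht)] at h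
  have hu := ballBound_nonneg hs.le ht
  refine (ENNReal.toReal_le_of_le_ofReal
    (mul_nonneg hu (ballBound_nonneg (mul_pos hs hq).le ht)) h).trans ?_
  set q := √(1 - r ^ 2)
  have hq1 : q ≤ 1 := by
    rw [← sq_le_one_iff₀ hq.le, hqr]; nlinarith [sq_nonneg r]
  have hqn : 1 ≤ √(n : ℝ) * q := by
    rw [← Real.sqrt_mul hn'.le]
    refine Real.one_le_sqrt.2 ?_
    have : (n : ℝ) * (1 / n) ≤ n * (1 - r ^ 2) := by gcongr; linarith
    rwa [mul_one_div_cancel hn'.ne'] at this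
  have hbound : 1 / q ≤ 1 + √(n : ℝ) * r ^ 2 := by
    rw [div_le_iff₀ hq]
    nlinarith [mul_nonneg (sub_nonneg.2 hqn) (sq_nonneg r)]
  have heq : ballBound (s * q) t = ballBound s t * (1 / q) := by
    unfold ballBound; field_simp
  rw [heq, ← mul_assoc, ← sq]
  gcongr

theorem sum_planted_flip_pair_le (hk : 0 < k) (hkn : k < n) (hS : S.card = k) {t : ℝ}
    (ht : 0 ≤ t) :
    ∑ T ∈ (Finset.univ : Finset (Fin n)).powersetCard k,
      (plantedMeasure σs).real ({X | hamiltonian X (flip σs S) ≤ t} ∩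
        {X | hamiltonian X (flip σs T) ≤ t})
      ≤ 2 * ballBound (residualSD ((k : ℝ) / n)) t +
        ballBound (residualSD ((k : ℝ) / n)) t ^ 2 * ((n.choose k : ℝ) *
          (1 + √(n : ℝ) * (n / ((n : ℝ) - k) ^ 2))) := by
  have := isProbabilityMeasure_plantedMeasure (hk.trans hkn) σs
  set u := ballBound (residualSD ((k : ℝ) / n)) t with hu_def
  have hu : 0 ≤ u :=
    ballBound_nonneg (residualSD_pos (ratio_pos hk hkn) (ratio_lt_one hk hkn)).le ht
  have hterm : ∀ T ∈ (Finset.univ : Finset (Fin n)).powersetCard k,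
      (plantedMeasure σs).real ({X | hamiltonian X (flip σs S) ≤ t} ∩
        {X | hamiltonian X (flip σs T) ≤ t})
      ≤ (if T = S then u else 0) + (if T = Sᶜ then u else 0) +
        u ^ 2 * (1 + √(n : ℝ) * setCorr n k (S ∩ T).card ^ 2) := by
    intro T hT
    rw [Finset.mem_powersetCard_univ] at hT
    have h0 : 0 ≤ u ^ 2 * (1 + √(n : ℝ) * setCorr n k (S ∩ T).card ^ 2) := by positivity
    have hsingle := (measureReal_mono (μ := plantedMeasure σs)
      (Set.inter_subset_left (s := {X | hamiltonian X (flip σs S) ≤ t})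
        (t := {X | hamiltonian X (flip σs T) ≤ t}))).trans (planted_flip_le hk hkn hS ht)
    by_cases h1 : T = S
    · rw [if_pos h1]
      have : 0 ≤ if T = Sᶜ then u else 0 := by split_ifs <;> simp [hu]
      linarith
    · by_cases h2 : T = Sᶜ
      · rw [if_neg h1, if_pos h2]
        linarith
      · rw [if_neg h1, if_neg h2, zero_add, zero_add]
        exact planted_flip_pair_le hk hkn hS hT h1 h2 ht
  have hite : ∀ (F : Finset (Finset (Fin n))) (R : Finset (Fin n)),
      ∑ T ∈ F, (if T = R then u else 0) ≤ u := by
    intro F R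
    rw [Finset.sum_ite_eq']
    split_ifs <;> simp [hu]
  refine (Finset.sum_le_sum hterm).trans ?_
  rw [Finset.sum_add_distrib, Finset.sum_add_distrib, ← Finset.mul_sum, Finset.sum_add_distrib,
    ← Finset.mul_sum, Finset.sum_const, Finset.card_powersetCard, Finset.card_univ,
    Fintype.card_fin, nsmul_eq_mul, mul_one]
  have h3 := sum_setCorr_sq_le hk hkn hS
  have h4 : u ^ 2 * ((n.choose k : ℝ) + √(n : ℝ) *
      ∑ T ∈ (Finset.univ : Finset (Fin n)).powersetCard k, setCorr n k (S ∩ T).card ^ 2)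
      ≤ u ^ 2 * ((n.choose k : ℝ) + √(n : ℝ) * ((n.choose k : ℝ) * n / ((n : ℝ) - k) ^ 2)) := by
    gcongr
  have h5 : u ^ 2 * ((n.choose k : ℝ) + √(n : ℝ) * ((n.choose k : ℝ) * n / ((n : ℝ) - k) ^ 2))
      = u ^ 2 * ((n.choose k : ℝ) * (1 + √(n : ℝ) * (n / ((n : ℝ) - k) ^ 2))) := by ring
  linarith [hite (Finset.univ.powersetCard k) S, hite (Finset.univ.powersetCard k) Sᶜ]

/-- First moment bound: small values of `H` on the sphere. -/
theorem planted_exists_le (hk : 0 < k) (hkn : k < n) {t : ℝ} (ht : 0 ≤ t) :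
    (plantedMeasure σs).real {X | ∃ σ ∈ sphere σs k, hamiltonian X σ ≤ t}
      ≤ (n.choose k : ℝ) * ballBound (residualSD ((k : ℝ) / n)) t := by
  have := isProbabilityMeasure_plantedMeasure (hk.trans hkn) σs
  have hset : {X | ∃ σ ∈ sphere σs k, hamiltonian X σ ≤ t}
      = ⋃ S ∈ (Finset.univ : Finset (Fin n)).powersetCard k,
        {X | hamiltonian X (flip σs S) ≤ t} := by
    ext X
    simp only [Set.mem_ofPred_eq, mem_sphere_iff hk hkn, Set.mem_iUnion, exists_prop]
    constructor
    · rintro ⟨σ, ⟨S, hS, rfl⟩, h⟩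
      exact ⟨S, hS, h⟩
    · rintro ⟨S, hS, h⟩
      exact ⟨_, ⟨S, hS, rfl⟩, h⟩
  rw [hset]
  refine (measureReal_biUnion_finset_le _ _).trans ?_
  refine (Finset.sum_le_card_nsmul _ _ (ballBound (residualSD ((k : ℝ) / n)) t) fun S hS =>
    planted_flip_le hk hkn (Finset.mem_powersetCard_univ.1 hS) ht).trans ?_
  rw [Finset.card_powersetCard, Finset.card_univ, Fintype.card_fin, nsmul_eq_mul]

theorem measurable_hamiltonian (σ : Spin n) :
    Measurable fun X : Fin n → ℝ => hamiltonian X σ := by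
  simp only [hamiltonian_eq_abs_dir]
  exact (measurable_dot _).abs

/-- Second moment bound: absence of small values of `H` on the sphere. -/
theorem planted_forall_lt_le (hk : 0 < k) (hkn : k < n) {t : ℝ} (ht : 0 < t) :
    (plantedMeasure σs).real {X | ∀ σ ∈ sphere σs k, t < hamiltonian X σ}
      ≤ 2 * (1 - Real.exp (-((((3 : ℝ) ^ n)⁻¹ + t) / residualSD ((k : ℝ) / n)) ^ 2 / 2))
        + 2 / ((n.choose k : ℝ) * ballBound (residualSD ((k : ℝ) / n)) t)
        + √(n : ℝ) * (n / ((n : ℝ) - k) ^ 2) := by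
  have := isProbabilityMeasure_plantedMeasure (hk.trans hkn) σs
  set F := (Finset.univ : Finset (Fin n)).powersetCard k with hF
  have hcard : F.card = n.choose k := by
    rw [hF, Finset.card_powersetCard, Finset.card_univ, Fintype.card_fin]
  have hset : {X | ∀ σ ∈ sphere σs k, t < hamiltonian X σ}
      = {X | ∀ S ∈ F, X ∉ {X | hamiltonian X (flip σs S) ≤ t}} := by
    ext X
    simp only [Set.mem_ofPred_eq, mem_sphere_iff hk hkn, not_le]
    constructor
    · exact fun h S hS => h _ ⟨S, hS, rfl⟩
    · rintro h _ ⟨S, hS, rfl⟩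
      exact h S hS
  set u := ballBound (residualSD ((k : ℝ) / n)) t with hu_def
  have hu : 0 < u := ballBound_pos (residualSD_pos (ratio_pos hk hkn) (ratio_lt_one hk hkn)) ht
  set N := (n.choose k : ℝ) with hN_def
  have hN : 0 < N := by rw [hN_def]; exact_mod_cast Nat.choose_pos hkn.le
  set x := Real.exp (-((((3 : ℝ) ^ n)⁻¹ + t) / residualSD ((k : ℝ) / n)) ^ 2 / 2)
  set y := √(n : ℝ) * (n / ((n : ℝ) - k) ^ 2)
  have hmain := measureReal_none_le (plantedMeasure σs) F
    (E := fun S => {X | hamiltonian X (flip σs S) ≤ t})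
    (fun S => measurableSet_le (measurable_hamiltonian (flip σs S)) measurable_const)
    (mul_pos hN hu)
  have hfirst : N * (u * x) ≤
      ∑ S ∈ F, (plantedMeasure σs).real {X | hamiltonian X (flip σs S) ≤ t} := by
    have := Finset.card_nsmul_le_sum F
      (fun S => (plantedMeasure σs).real {X | hamiltonian X (flip σs S) ≤ t}) (u * x)
      fun S hS => le_planted_flip hk hkn (Finset.mem_powersetCard_univ.1 hS) ht.le
    rwa [hcard, nsmul_eq_mul] at this
  have hsecond : ∑ S ∈ F, ∑ T ∈ F, (plantedMeasure σs).real
      ({X | hamiltonian X (flip σs S) ≤ t} ∩ {X | hamiltonian X (flip σs T) ≤ t})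
      ≤ N * (2 * u + u ^ 2 * (N * (1 + y))) := by
    have := Finset.sum_le_card_nsmul F
      (fun S => ∑ T ∈ F, (plantedMeasure σs).real
        ({X | hamiltonian X (flip σs S) ≤ t} ∩ {X | hamiltonian X (flip σs T) ≤ t})) _
      fun S hS => sum_planted_flip_pair_le hk hkn (Finset.mem_powersetCard_univ.1 hS) ht.le
    rwa [hcard, nsmul_eq_mul] at this
  rw [hset]
  refine hmain.trans ?_
  calc _ ≤ 1 - 2 / (N * u) * (N * (u * x))
        + 1 / (N * u) ^ 2 * (N * (2 * u + u ^ 2 * (N * (1 + y)))) := by gcongr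
    _ = _ := by field_simp; ring

end Fixed

/-! ### Passage to the limit -/

/-- The two moment bounds combined. The truncated level `t'` may be any positive number below the
upper level `t₂`. -/
theorem le_planted_zeta_between {n k : ℕ} {σs : Spin n} (hk : 0 < k) (hkn : k < n)
    {t₁ t' t₂ : ℝ} (ht₁ : 0 ≤ t₁) (ht' : 0 < t') (ht : t' ≤ t₂) :
    ENNReal.ofReal (1 - (n.choose k : ℝ) * ballBound (residualSD ((k : ℝ) / n)) t₁
      - (2 * (1 - Real.exp (-((((3 : ℝ) ^ n)⁻¹ + t') / residualSD ((k : ℝ) / n)) ^ 2 / 2))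
        + 2 / ((n.choose k : ℝ) * ballBound (residualSD ((k : ℝ) / n)) t')
        + √(n : ℝ) * (n / ((n : ℝ) - k) ^ 2)))
      ≤ plantedMeasure σs {X | t₁ ≤ zeta σs k X ∧ zeta σs k X ≤ t₂} := by
  have := isProbabilityMeasure_plantedMeasure (hk.trans hkn) σs
  have hA := planted_exists_le (σs := σs) hk hkn ht₁
  have hB := planted_forall_lt_le (σs := σs) hk hkn ht'
  set G := {X | t₁ ≤ zeta σs k X ∧ zeta σs k X ≤ t₂}
  set A := {X : Fin n → ℝ | ∃ σ ∈ sphere σs k, hamiltonian X σ ≤ t₁}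
  set B := {X : Fin n → ℝ | ∀ σ ∈ sphere σs k, t' < hamiltonian X σ}
  have hcov : Set.univ ⊆ G ∪ A ∪ B := by
    intro X _
    by_contra hX
    simp only [Set.mem_union, not_or] at hX
    obtain ⟨⟨hG, hA⟩, hB⟩ := hX
    have hz := isLeast_zeta σs hk hkn X
    refine hG ⟨?_, ?_⟩
    · obtain ⟨σ, hσ, h⟩ := hz.1
      by_contra hlt
      exact hA ⟨σ, hσ, by rw [h]; exact (not_le.1 hlt).le⟩
    · by_contra hgt
      refine hB fun σ hσ => ?_
      exact ht.trans_lt ((not_le.1 hgt).trans_le (hz.2 ⟨σ, hσ, rfl⟩))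
  have h1 : (1 : ℝ) ≤ (plantedMeasure σs).real G + (plantedMeasure σs).real A
      + (plantedMeasure σs).real B := by
    rw [← probReal_univ (μ := plantedMeasure σs)]
    exact (measureReal_mono hcov).trans ((measureReal_union_le _ _).trans
      (add_le_add_left (measureReal_union_le _ _) _))
  rw [ENNReal.ofReal_le_iff_le_toReal (measure_ne_top _ _)]
  change _ ≤ (plantedMeasure σs).real G
  linarith

theorem tendsto_scale {ρ : ℝ} (hρ0 : 0 < ρ) (hρ1 : ρ < 1) :
    Tendsto (fun n : ℕ => (n : ℝ) * (√(n : ℝ) * (2 : ℝ) ^ (-((n : ℝ) * hb ρ)))) atTop (𝓝 0) := by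
  have hb := Real.binEntropy_pos hρ0 hρ1
  have h := (tendsto_rpow_mul_exp_neg_mul_atTop_nhds_zero 2 _ hb).comp
    (tendsto_natCast_atTop_atTop (R := ℝ))
  refine squeeze_zero' (.of_forall fun n => by positivity) ?_ h
  filter_upwards [eventually_ge_atTop 1] with n hn
  have hn' : (1 : ℝ) ≤ n := by exact_mod_cast hn
  have h2 : √(n : ℝ) ≤ n := by
    rw [Real.sqrt_le_left (by linarith)]
    nlinarith
  simp only [Function.comp_apply]
  rw [two_rpow_neg_mul_hb, ← mul_assoc, Real.rpow_two, sq, neg_mul, mul_comm (n : ℝ) (_ : ℝ)]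
  gcongr ?_ * ?_
  · nlinarith
  · rw [mul_comm]

theorem tendsto_zeta_between {ρ : ℝ} (hρ0 : 0 < ρ) (hρ1 : ρ < 1)
    {f g : ℕ → ℝ} (hf_pos : ∀ n, 0 < f n) (hg_pos : ∀ n, 0 < g n)
    (hf : Tendsto f atTop (𝓝 0)) (hg : Tendsto g atTop atTop)
    (σstar : ∀ n : ℕ, Spin n) {k : ℕ → ℕ} (hk : ∀ n : ℕ, |(k n : ℝ) - ρ * n| ≤ 1) :
    Tendsto
      (fun n : ℕ => plantedMeasure (σstar n)
        {X | f n * (√(n : ℝ) * (2 : ℝ) ^ (-((n : ℝ) * hb ρ))) ≤ zeta (σstar n) (k n) X ∧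
            zeta (σstar n) (k n) X ≤ g n * (√(n : ℝ) * (2 : ℝ) ^ (-((n : ℝ) * hb ρ)))})
      atTop (𝓝 1) := by
  set a : ℕ → ℝ := fun n => √(n : ℝ) * (2 : ℝ) ^ (-((n : ℝ) * hb ρ)) with ha
  -- Truncating `g` at `n` keeps it divergent and makes the upper level tend to `0`, so that the
  -- Gaussian density is nearly constant on the intervals that matter.
  set h : ℕ → ℝ := fun n => min (g n) n with hh
  set s : ℕ → ℝ := fun n => residualSD ((k n : ℝ) / n) with hs
  have hnat : Tendsto (fun n : ℕ => (n : ℝ)) atTop atTop := tendsto_natCast_atTop_atTop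
  have hκ := tendsto_div_of_rounding hk
  have hs_lim : Tendsto s atTop (𝓝 (residualSD ρ)) :=
    ((Real.continuous_sqrt.tendsto _).comp (hκ.mul (tendsto_const_nhds.sub hκ))).const_mul 2
  have hs0 : 0 < residualSD ρ := residualSD_pos hρ0 hρ1
  have hκ0 : ∀ᶠ n : ℕ in atTop, 0 < k n := by
    filter_upwards [hκ.eventually (lt_mem_nhds hρ0)] with n h0
    rw [Nat.pos_iff_ne_zero]; rintro h; rw [h] at h0; simp at h0
  have hκ1 : ∀ᶠ n : ℕ in atTop, k n < n := by
    filter_upwards [hκ.eventually (gt_mem_nhds hρ1), eventually_gt_atTop 0] with n h1 hn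
    rw [div_lt_one (by exact_mod_cast hn)] at h1; exact_mod_cast h1
  obtain ⟨c, C, hc, hcC⟩ := choose_two_sided hρ0 hρ1 hk
  have hpi : 0 < √(2 * Real.pi) := by positivity
  have hball : ∀ (n : ℕ) (w : ℝ), (n.choose (k n) : ℝ) * ballBound (s n) (w * a n)
      = w * ((n.choose (k n) : ℝ) * a n) * (2 / (s n * √(2 * Real.pi))) := by
    intro n w; unfold ballBound; ring
  have hfac : Tendsto (fun n => 2 / (s n * √(2 * Real.pi))) atTop
      (𝓝 (2 / (residualSD ρ * √(2 * Real.pi)))) :=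
    tendsto_const_nhds.div (hs_lim.mul_const _) (by positivity)
  have hlow : Tendsto (fun n : ℕ => (n.choose (k n) : ℝ) * ballBound (s n) (f n * a n)) atTop
      (𝓝 0) := by
    simp only [hball]
    have h1 : Tendsto (fun n : ℕ => f n * ((n.choose (k n) : ℝ) * a n)) atTop (𝓝 0) := by
      have h2 := hf.mul_const C
      rw [zero_mul] at h2
      refine squeeze_zero' (.of_forall fun n => ?_) ?_ h2
      · have := (hf_pos n).le
        positivity
      · filter_upwards [hcC] with n hn
        exact mul_le_mul_of_nonneg_left hn.2 (hf_pos n).le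
    simpa using h1.mul hfac
  have hh_top : Tendsto h atTop atTop := by
    rw [tendsto_atTop]
    intro b
    filter_upwards [hg.eventually_ge_atTop b, hnat.eventually_ge_atTop b] with n h1 h2
    exact le_min h1 h2
  have hlevel : Tendsto (fun n => h n * a n) atTop (𝓝 0) := by
    refine squeeze_zero (fun n => ?_) (fun n => ?_) (tendsto_scale hρ0 hρ1)
    · have : 0 ≤ h n := le_min (hg_pos n).le (Nat.cast_nonneg n)
      positivity
    · exact mul_le_mul_of_nonneg_right (min_le_right _ _) (by positivity)
  have hexp : Tendsto (fun n : ℕ => 2 * (1 - Real.exp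
      (-((((3 : ℝ) ^ n)⁻¹ + h n * a n) / s n) ^ 2 / 2))) atTop (𝓝 0) := by
    have h3 : Tendsto (fun n : ℕ => ((3 : ℝ) ^ n)⁻¹) atTop (𝓝 0) :=
      tendsto_inv_atTop_zero.comp (tendsto_pow_atTop_atTop_of_one_lt (by norm_num))
    have h4 : Tendsto (fun n : ℕ => 2 * (1 - Real.exp
        (-((((3 : ℝ) ^ n)⁻¹ + h n * a n) / s n) ^ 2 / 2))) atTop
        (𝓝 (2 * (1 - Real.exp (-((0 + 0) / residualSD ρ) ^ 2 / 2)))) :=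
      (tendsto_const_nhds.sub ((Real.continuous_exp.tendsto _).comp
        (((((h3.add hlevel).div hs_lim hs0.ne').pow 2).neg).div_const 2))).const_mul 2
    simpa using h4
  have hinv : Tendsto (fun n : ℕ => 2 / ((n.choose (k n) : ℝ) * ballBound (s n) (h n * a n)))
      atTop (𝓝 0) := by
    refine tendsto_const_nhds.div_atTop ?_
    simp only [hball]
    refine Tendsto.atTop_mul_pos (by positivity) ?_ hfac
    refine tendsto_atTop_mono' _ ?_ (hh_top.atTop_mul_const hc)
    filter_upwards [hcC, hh_top.eventually_ge_atTop 0] with n hn h0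
    exact mul_le_mul_of_nonneg_left hn.1 h0
  have hvar : Tendsto (fun n : ℕ => √(n : ℝ) * (n / ((n : ℝ) - k n) ^ 2)) atTop (𝓝 0) := by
    have h1 : Tendsto (fun n : ℕ => (√(n : ℝ))⁻¹ * ((1 - (k n : ℝ) / n) ^ 2)⁻¹) atTop
        (𝓝 (0 * ((1 - ρ) ^ 2)⁻¹)) :=
      (tendsto_inv_atTop_zero.comp (Real.tendsto_sqrt_atTop.comp hnat)).mul
        (((tendsto_const_nhds.sub hκ).pow 2).inv₀ (pow_pos (sub_pos.2 hρ1) 2).ne')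
    rw [zero_mul] at h1
    refine h1.congr' ?_
    filter_upwards [hκ1, eventually_gt_atTop 0] with n h2 hn
    have hn' : (0 : ℝ) < n := by exact_mod_cast hn
    have h3 : (0 : ℝ) < (n : ℝ) - k n := by rw [sub_pos]; exact_mod_cast h2
    have h4 : 1 - (k n : ℝ) / n = ((n : ℝ) - k n) / n := by field_simp
    have hsq : 0 < √(n : ℝ) := Real.sqrt_pos.2 hn'
    have hsq2 : √(n : ℝ) ^ 2 = n := Real.sq_sqrt hn'.le
    rw [h4]
    field_simp
    rw [hsq2]
  have hlim := ENNReal.tendsto_ofReal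
    ((tendsto_const_nhds (x := (1 : ℝ))).sub hlow |>.sub ((hexp.add hinv).add hvar))
  simp only [sub_zero, add_zero, ENNReal.ofReal_one] at hlim
  refine tendsto_of_tendsto_of_tendsto_of_le_of_le' hlim tendsto_const_nhds ?_ ?_
  · filter_upwards [hκ0, hκ1] with n h0 h1
    have hn' : (0 : ℝ) < n := by exact_mod_cast h0.trans h1
    have han : 0 < a n := mul_pos (Real.sqrt_pos.2 hn') (Real.rpow_pos_of_pos two_pos _)
    exact le_planted_zeta_between h0 h1 (mul_pos (hf_pos n) han).le
      (mul_pos (lt_min (hg_pos n) hn') han)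
      (mul_le_mul_of_nonneg_right (min_le_left _ _) han.le)
  · filter_upwards [eventually_gt_atTop 0] with n hn
    have := isProbabilityMeasure_plantedMeasure hn (σstar n)
    exact prob_le_one

end PlantedNPP

/-- The distance `ρ n` is rounded to an integer `k n`, down or up, arbitrarily for each `n`;
whenever `ρ n` is an integer, `k n = ρ n`. -/
theorem mainTheorem2 (ρ : ℝ) (hρ0 : 0 < ρ) (hρ1 : ρ < 1)
    (f g : ℕ → ℝ) (hf_pos : ∀ n, 0 < f n) (hg_pos : ∀ n, 0 < g n)
    (hf : Tendsto f atTop (𝓝 0)) (hg : Tendsto g atTop atTop)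
    (σstar : ∀ n : ℕ, PlantedNPP.Spin n)
    (k : ℕ → ℕ) (hk : ∀ n, k n = ⌊ρ * (n : ℝ)⌋₊ ∨ k n = ⌈ρ * (n : ℝ)⌉₊) :
    Tendsto
      (fun n : ℕ => PlantedNPP.plantedMeasure (σstar n)
        {X | f n * √(n : ℝ) * (2 : ℝ) ^ (-((n : ℝ) * PlantedNPP.hb ρ))
              ≤ PlantedNPP.zeta (σstar n) (k n) X ∧
            PlantedNPP.zeta (σstar n) (k n) X
              ≤ g n * √(n : ℝ) * (2 : ℝ) ^ (-((n : ℝ) * PlantedNPP.hb ρ))})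
      atTop (𝓝 1) := by
  simp only [mul_assoc (f _), mul_assoc (g _)]
  exact PlantedNPP.tendsto_zeta_between hρ0 hρ1 hf_pos hg_pos hf hg σstar fun n =>
    PlantedNPP.abs_sub_le_one_of_rounding (by positivity) (hk n)
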